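/- For $N\ge 1$ let $\mathscr D_N$ be the set of dimer configurations on the complete graph with vertex set $\{1,\dots,N\}$, i.e. of sets $D$ of pairwise non-incident edges. Let $S_N(D)$ be the number of monomers (vertices not covered by any edge of $D$) and $m_N=S_N/N$. For $h\in\mathbb R$ and $J>0$ the imitative monomer-dimer model is given by the Hamiltonian $-H_N(D)=N\big((h-J)\,m_N(D)+J\,m_N(D)^2\big)$ and the Gibbs probability measure $$\mu_N(D)=\frac1{Z_N}\,N^{-|D|}\,e^{-H_N(D)},\qquad D\in\mathscr D_N,\qquad Z_N=\sum_{D\in\mathscr D_N}N^{-|D|}e^{-H_N(D)} .$$ Put $$g(x)=\frac{e^{x}}2\Big(\sqrt{e^{2x}+4}-e^{x}\Big),\qquad p^{(0)}(x)=-\frac{1-g(x)}2-\frac12\log\big(1-g(x)\big),\qquad \widetilde p(m)=\widetilde p_{h,J}(m)=-Jm^2+p^{(0)}\big((2m-1)J+h\big).$$ Let $\gamma\subset\mathbb R\times(0,\infty)$ be the coexistence curve, i.e. the set of the points $(h,J)$ at which $\widetilde p$ has two distinct global maximum points on $\mathbb R$. There is exactly one point $(h_c,J_c)$ (the critical point,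 the endpoint of $\gamma$) in $\overline\gamma\setminus\gamma$, with closure taken in $\mathbb R^2$; it satisfies $J_c>0$, and the following hold. (i) For every $(h,J)\in(\mathbb R\times(0,\infty))\setminus(\gamma\cup\{(h_c,J_c)\})$ the function $\widetilde p$ has a unique global maximum point $m^*$, $\lambda:=\frac{\partial^2}{\partial m^2}\widetilde p(m^*)<0$, $\sigma^2:=-\lambda^{-1}-(2J)^{-1}>0$, and, under $\mu_N$, as $N\to\infty$, $$\frac{S_N-N m^*}{N^{1/2}}\ \xrightarrow{\ \mathcal D\ }\ \mathcal N(0,\sigma^2).$$ (ii) At $(h,J)=(h_c,J_c)$ the function $\widetilde p$ has a unique global maximum point $m_c$, $\lambda_c:=\frac{\partial^4}{\partial m^4}\widetilde p(m_c)<0$, and, under $\mu_N$, as $N\to\infty$, $$\frac{S_N-N m_c}{N^{3/4}}\ \xrightarrow{\ \mathcal D\ }\ C\exp\Big(\frac{\lambda_c}{24}x^4\Big)\,dx,\qquad C^{-1}=\int_{\mathbb R}\exp\Big(\frac{\lambda_c}{24}x^4\Big)dx<\infty .$$ -/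

import Mathlib

open MeasureTheory ProbabilityTheory Filter

noncomputable section

namespace IMD

/-- `D` is a dimer configuration on the graph `G`: a set of edges of `G` such that each vertex `v`
has at most one `u` with `uv ∈ D`. -/
def IsDimerConfig {V : Type*} (G : SimpleGraph V) (D : Finset (Sym2 V)) : Prop :=
  (∀ e ∈ D, e ∈ G.edgeSet) ∧ ∀ v u u' : V, s(u, v) ∈ D → s(u', v) ∈ D → u = u'

/-- The configuration space of dimer configurations on the graph `G`. -/
def DimerConfig {V : Type*} (G : SimpleGraph V) : Type _ :=
  {D : Finset (Sym2 V) // IsDimerConfig G D}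

instance {V : Type*} [Finite V] (G : SimpleGraph V) : Finite (DimerConfig G) :=
  inferInstanceAs (Finite {D : Finset (Sym2 V) // IsDimerConfig G D})

instance {V : Type*} [Finite V] (G : SimpleGraph V) : Fintype (DimerConfig G) :=
  Fintype.ofFinite _

instance {V : Type*} (G : SimpleGraph V) : Nonempty (DimerConfig G) :=
  ⟨⟨∅, by simp [IsDimerConfig]⟩⟩

instance {V : Type*} (G : SimpleGraph V) : MeasurableSpace (DimerConfig G) := ⊤

/-- The set of monomers (dimer-free vertices) of a dimer configuration. -/
def monomers {V : Type*} {G : SimpleGraph V} (D : DimerConfig G) : Set V :=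
  {v | ∀ u : V, s(u, v) ∉ D.1}

/-- The configuration space on the complete graph with `N` vertices. -/
abbrev Config (N : ℕ) : Type := DimerConfig (⊤ : SimpleGraph (Fin N))

/-- The number of monomers `S_N(D)`. -/
def numMonomers {N : ℕ} (D : Config N) : ℕ := (monomers D).ncard

/-- The empirical monomer density `m_N(D) = S_N(D) / N`. -/
def monomerDensity {N : ℕ} (D : Config N) : ℝ := (numMonomers D : ℝ) / (N : ℝ)

/-- The Hamiltonian, `-H_N(D) = N ((h - J) m_N(D) + J m_N(D)²)`. -/
def hamiltonian (h J : ℝ) {N : ℕ} (D : Config N) : ℝ :=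
  -((N : ℝ) * ((h - J) * monomerDensity D + J * monomerDensity D ^ 2))

/-- The Gibbs weight `N^{-|D|} exp(-H_N(D))`. -/
def gibbsWeight (h J : ℝ) {N : ℕ} (D : Config N) : ℝ :=
  ((N : ℝ) ^ D.1.card)⁻¹ * Real.exp (-hamiltonian h J D)

/-- The partition function. -/
def partitionFunction (h J : ℝ) (N : ℕ) : ℝ := ∑ D : Config N, gibbsWeight h J D

/-- The Gibbs measure `μ_N` on the configuration space. -/
def gibbsMeasure (h J : ℝ) (N : ℕ) : Measure (Config N) :=
  ∑ D : Config N,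
    ENNReal.ofReal (gibbsWeight h J D / partitionFunction h J N) • Measure.dirac D

lemma gibbsWeight_pos (h J : ℝ) {N : ℕ} (D : Config N) : 0 < gibbsWeight h J D := by
  unfold gibbsWeight
  refine mul_pos (inv_pos.2 ?_) (Real.exp_pos _)
  rcases Nat.eq_zero_or_pos N with rfl | hN
  · have : D.1 = ∅ := by
      ext e
      induction e with
      | h x y => exact x.elim0
    simp [this]
  · positivity

lemma partitionFunction_pos (h J : ℝ) (N : ℕ) : 0 < partitionFunction h J N :=
  Finset.sum_pos (fun D _ => gibbsWeight_pos h J D) Finset.univ_nonempty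

instance (h J : ℝ) (N : ℕ) : IsProbabilityMeasure (gibbsMeasure h J N) := by
  constructor
  have hZ := partitionFunction_pos h J N
  simp only [gibbsMeasure, Measure.coe_finsetSum, Finset.sum_apply, Measure.smul_apply,
    measure_univ, smul_eq_mul, mul_one]
  rw [← ENNReal.ofReal_sum_of_nonneg
    (fun D _ => div_nonneg (gibbsWeight_pos h J D).le hZ.le), ← Finset.sum_div]
  have : (∑ D : Config N, gibbsWeight h J D) = partitionFunction h J N := rfl
  rw [this, div_self hZ.ne', ENNReal.ofReal_one]

/-- `g(h) = (e^h / 2) (√(e^{2h} + 4) - e^h)`. -/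
def g (h : ℝ) : ℝ := Real.exp h / 2 * (Real.sqrt (Real.exp (2 * h) + 4) - Real.exp h)

/-- The limiting pressure of the pure hard-core model,
`p⁽⁰⁾(h) = -(1 - g(h)) / 2 - (1 / 2) log (1 - g(h))`. -/
def purePressure (h : ℝ) : ℝ := -(1 - g h) / 2 - 1 / 2 * Real.log (1 - g h)

/-- The variational pressure `p̃(m) = -J m² + p⁽⁰⁾((2m - 1) J + h)`. -/
def variationalPressure (h J : ℝ) (m : ℝ) : ℝ :=
  -J * m ^ 2 + purePressure ((2 * m - 1) * J + h)

/-- `m` is a global maximum point of `f : ℝ → ℝ`. -/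
def IsGlobalMax (f : ℝ → ℝ) (m : ℝ) : Prop := ∀ x : ℝ, f x ≤ f m

/-- `m` is the unique global maximum point of `f : ℝ → ℝ`. -/
def IsUniqueGlobalMax (f : ℝ → ℝ) (m : ℝ) : Prop :=
  IsGlobalMax f m ∧ ∀ x : ℝ, IsGlobalMax f x → x = m

/-- The coexistence curve `γ`: the points `(h, J)` with `J > 0` at which the variational pressure
has two distinct global maximum points. -/
def coexistenceCurve : Set (ℝ × ℝ) :=
  {p | 0 < p.2 ∧ ∃ m₁ m₂ : ℝ, m₁ < m₂ ∧
    IsGlobalMax (variationalPressure p.1 p.2) m₁ ∧ IsGlobalMax (variationalPressure p.1 p.2) m₂}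

/-- The measure `C exp (lam x⁴ / 24) dx` on `ℝ`, with `C⁻¹ = ∫ exp (lam x⁴ / 24) dx`. -/
def quarticMeasure (lam : ℝ) : Measure ℝ :=
  volume.withDensity fun x : ℝ =>
    ENNReal.ofReal ((∫ y : ℝ, Real.exp (lam / 24 * y ^ 4))⁻¹ * Real.exp (lam / 24 * x ^ 4))

end IMD

end

/-! The law of the monomer number is explicit. There are N!/((N-2d)! d! 2^d) configurations with d
dimers. Hence, up to a factor independent of d, those of monomer density x = (N-2d)/N carry total
weight exp(N · `rate` x) divided by the Stirling ratios of N-2d and d, with no error term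
(`card_configsOfCard_mul_exp`). Both limit theorems are then Laplace's method for a lattice sum
(`tendsto_sum_normWeight`): if `rate` has a unique maximum point m on [0,1] and `rate` y - `rate` m
~ -κ (y-m)^k with k even, the fluctuations of S_N around N m live on the scale N^(1-1/k), with
limiting density proportional to exp(-κ x^k). Here k = 2 away from the critical point and k = 4 at
it.

The link with the variational pressure is that `rate` lies below it on [0,1] and agrees with it at
its critical points, which are the fixed points of m ↦ `g` (`effField` h J m). So the global maximum
points of the pressure lie in (0,1) and maximize `rate`, and uniqueness carries over
(`IsUniqueGlobalMax.rate_lt`).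

The phase diagram comes from rate'' = 2J - `gInvDeriv`, where `gInvDeriv` decreases up to
`critDensity`, increases after it, and has minimum 2 `critJ`. For J ≤ `critJ` there is one critical
point. For J > `critJ` a connectedness argument in h yields two maximum points, which must straddle
`critDensity`. In the limit J → `critJ` they can only merge there, which pins the endpoint
(`closure_diff_coexistenceCurve`). The same monotonicity makes every maximum nondegenerate except at
the endpoint, where rate'' vanishes to order exactly two. -/

open scoped Topology

namespace IMD

/-! ### The function `g`, its inverse and the rate function -/

/-- The inverse function of `g` on `(0, 1)`. -/
noncomputable def gInv (m : ℝ) : ℝ := Real.log m - Real.log (1 - m) / 2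

/-- The derivative of `gInv`. -/
noncomputable def gInvDeriv (m : ℝ) : ℝ := m⁻¹ + (1 - m)⁻¹ / 2

/-- The external field acting in the variational pressure. -/
noncomputable def effField (h J m : ℝ) : ℝ := (2 * m - 1) * J + h

/-- The rate function of the monomer density (entropy plus energy). -/
noncomputable def rate (h J x : ℝ) : ℝ :=
  J * x ^ 2 + (h - J) * x - x * Real.log x - (1 - x) * Real.log (1 - x) / 2 - (1 - x) / 2

/-- `g x` is a root of the quadratic t² + e^(2x) t - e^(2x) = 0. The bound `g x < 1` and, after
taking logarithms, the formula for the inverse are read off from this form. -/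
lemma g_sq (x : ℝ) : g x ^ 2 = Real.exp (2 * x) * (1 - g x) := by
  have h1 : Real.exp (2 * x) = Real.exp x ^ 2 := by rw [← Real.exp_nat_mul]; norm_num
  have h2 : Real.sqrt (Real.exp (2 * x) + 4) ^ 2 = Real.exp (2 * x) + 4 :=
    Real.sq_sqrt (by positivity)
  unfold g
  rw [h1] at *
  set e := Real.exp x
  set s := Real.sqrt (e ^ 2 + 4)
  linear_combination (e ^ 2 / 4) * h2

lemma g_pos (x : ℝ) : 0 < g x := by
  unfold g
  have : Real.exp x < Real.sqrt (Real.exp (2 * x) + 4) := by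
    apply Real.lt_sqrt_of_sq_lt
    rw [← Real.exp_nat_mul]
    norm_num
  have := Real.exp_pos x
  apply mul_pos <;> linarith

lemma g_lt_one (x : ℝ) : g x < 1 := by
  have h1 := g_sq x
  have h2 := g_pos x
  have h3 := Real.exp_pos (2 * x)
  by_contra! h
  nlinarith

lemma gInv_g (x : ℝ) : gInv (g x) = x := by
  have h1 := congrArg Real.log (g_sq x)
  have h2 := g_pos x
  have h3 := g_lt_one x
  rw [Real.log_pow, Real.log_mul (Real.exp_pos _).ne' (by linarith), Real.log_exp] at h1
  push_cast at h1
  unfold gInv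
  linarith

lemma strictMonoOn_gInv : StrictMonoOn gInv (Set.Ioo 0 1) := by
  intro a ha b hb hab
  have h1 := Real.log_lt_log ha.1 hab
  have h2 := Real.log_lt_log (x := 1 - b) (y := 1 - a) (by linarith [hb.2]) (by linarith)
  unfold gInv
  linarith

lemma g_mem (x : ℝ) : g x ∈ Set.Ioo (0 : ℝ) 1 := ⟨g_pos x, g_lt_one x⟩

lemma continuous_g : Continuous g := by
  unfold g
  fun_prop

lemma hasDerivAt_gInv {m : ℝ} (hm : m ∈ Set.Ioo (0 : ℝ) 1) :
    HasDerivAt gInv (gInvDeriv m) m := by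
  have h1 := Real.hasDerivAt_log hm.1.ne'
  have h2 := ((hasDerivAt_id m).const_sub 1).log (sub_pos.2 hm.2).ne'
  convert! h1.sub (h2.div_const 2) using 1
  simp [gInvDeriv]
  ring

lemma gInvDeriv_pos {m : ℝ} (hm : m ∈ Set.Ioo (0 : ℝ) 1) : 0 < gInvDeriv m := by
  have := hm.1
  have : 0 < 1 - m := sub_pos.2 hm.2
  unfold gInvDeriv
  positivity

lemma hasDerivAt_g (x : ℝ) : HasDerivAt g (gInvDeriv (g x))⁻¹ x :=
  HasDerivAt.of_local_left_inverse continuous_g.continuousAt (hasDerivAt_gInv (g_mem x))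
    (gInvDeriv_pos (g_mem x)).ne' (Eventually.of_forall gInv_g)

lemma hasDerivAt_purePressure (x : ℝ) : HasDerivAt purePressure (g x) x := by
  have h0 := hasDerivAt_g x
  have h1 := (h0.const_sub 1)
  have h2 := h1.log (sub_pos.2 (g_lt_one x)).ne'
  have h3 := (h1.neg.div_const 2).sub (h2.const_mul (1 / 2))
  convert! h3 using 1
  have ha := g_pos x
  have hb : 0 < 1 - g x := sub_pos.2 (g_lt_one x)
  have hc : 0 < gInvDeriv (g x) := gInvDeriv_pos (g_mem x)
  field_simp
  unfold gInvDeriv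
  field_simp
  ring

/-! ### Variational pressure against rate function -/

lemma hasDerivAt_effField (h J m : ℝ) : HasDerivAt (effField h J) (2 * J) m := by
  have := ((((hasDerivAt_id m).const_mul 2).sub_const 1).mul_const J).add_const h
  convert! this using 1
  ring

/-- Critical points are thus fixed points `g (effField h J m) = m`; applying `gInv` turns this into
`rateDeriv h J m = 0`. -/
lemma hasDerivAt_variationalPressure (h J m : ℝ) :
    HasDerivAt (variationalPressure h J) (2 * J * (g (effField h J m) - m)) m := by
  have h1 := (hasDerivAt_purePressure (effField h J m)).comp m (hasDerivAt_effField h J m)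
  have h2 := ((hasDerivAt_pow 2 m).const_mul (-J)).add h1
  convert! h2 using 1
  simp
  ring

lemma continuous_purePressure : Continuous purePressure :=
  continuous_iff_continuousAt.2 fun x => (hasDerivAt_purePressure x).continuousAt

lemma continuous_variationalPressure (h J : ℝ) : Continuous (variationalPressure h J) :=
  continuous_iff_continuousAt.2 fun x => (hasDerivAt_variationalPressure h J x).continuousAt

lemma continuous_rate (h J : ℝ) : Continuous (rate h J) := by
  unfold rate
  have h1 := Real.continuous_mul_log
  have h2 : Continuous fun x : ℝ => (1 - x) * Real.log (1 - x) :=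
    h1.comp (continuous_const.sub continuous_id)
  fun_prop

/-- This is log u ≤ u - 1 at u = t/x; at x = 0 the convention 0 · log 0 = 0 is the right one. -/
lemma sub_le_mul_log_div {x t : ℝ} (hx : 0 ≤ x) (ht : 0 < t) :
    x - t ≤ x * Real.log x - x * Real.log t := by
  rcases hx.eq_or_lt with rfl | hx
  · simp [ht.le]
  · have h1 := Real.log_le_sub_one_of_pos (div_pos ht hx)
    rw [Real.log_div ht.ne' hx.ne'] at h1
    have h2 := mul_le_mul_of_nonneg_left h1 hx.le
    have h3 : x * (t / x - 1) = t - x := by field_simp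
    linarith

/-- With t = `g (effField h J x)`, the gap is the relative-entropy term x log(x/t) - (x - t) plus
half the same term for 1-x against 1-t. Both are nonnegative and vanish at x = t. -/
lemma rate_le_variationalPressure (h J : ℝ) {x : ℝ} (hx : x ∈ Set.Icc (0 : ℝ) 1) :
    rate h J x ≤ variationalPressure h J x := by
  set t := g (effField h J x) with ht
  have h0 : gInv t = (2 * x - 1) * J + h := gInv_g _
  have h1 := sub_le_mul_log_div hx.1 (g_pos (effField h J x))
  have h2 := sub_le_mul_log_div (sub_nonneg.2 hx.2) (sub_pos.2 (g_lt_one (effField h J x)))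
  rw [← ht] at h1 h2
  have h3 : variationalPressure h J x = -J * x ^ 2 + (-(1 - t) / 2 - 1 / 2 * Real.log (1 - t)) :=
    rfl
  rw [h3]
  unfold rate
  unfold gInv at h0
  have h4 : x * (Real.log t - Real.log (1 - t) / 2) = x * ((2 * x - 1) * J + h) := by rw [h0]
  nlinarith

lemma rate_eq_variationalPressure {h J m : ℝ} (hm : g (effField h J m) = m) :
    rate h J m = variationalPressure h J m := by
  have h0 : gInv m = (2 * m - 1) * J + h := by
    rw [← gInv_g ((2 * m - 1) * J + h)]
    exact congrArg gInv hm.symm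
  have h3 : variationalPressure h J m = -J * m ^ 2 + (-(1 - g (effField h J m)) / 2
      - 1 / 2 * Real.log (1 - g (effField h J m))) := rfl
  rw [h3, hm]
  unfold rate
  unfold gInv at h0
  have h4 : m * (Real.log m - Real.log (1 - m) / 2) = m * ((2 * m - 1) * J + h) := by rw [h0]
  linarith

/-- The derivative of the rate function on `(0, 1)`. -/
noncomputable def rateDeriv (h J x : ℝ) : ℝ := effField h J x - gInv x

lemma hasDerivAt_rate (h J : ℝ) {x : ℝ} (hx : x ∈ Set.Ioo (0 : ℝ) 1) :
    HasDerivAt (rate h J) (rateDeriv h J x) x := by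
  have ha : 1 - x ≠ 0 := (sub_pos.2 hx.2).ne'
  have h1 := Real.hasDerivAt_mul_log hx.1.ne'
  have h2 := (Real.hasDerivAt_mul_log ha).comp x ((hasDerivAt_id x).const_sub 1)
  have h3 := ((((hasDerivAt_pow 2 x).const_mul J).add ((hasDerivAt_id x).const_mul (h - J))).sub
    h1).sub (h2.div_const 2)
  have h4 := h3.sub (((hasDerivAt_id x).const_sub 1).div_const 2)
  convert! h4 using 1
  simp [rateDeriv, effField, gInv]
  ring

lemma hasDerivAt_rateDeriv (h J : ℝ) {x : ℝ} (hx : x ∈ Set.Ioo (0 : ℝ) 1) :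
    HasDerivAt (rateDeriv h J) (2 * J - gInvDeriv x) x :=
  (hasDerivAt_effField h J x).sub (hasDerivAt_gInv hx)

/-! ### The critical point and the convexity of the rate function -/

/-- The monomer density at the critical point. -/
noncomputable def critDensity : ℝ := 2 - √2

/-- The imitation coefficient at the critical point. -/
noncomputable def critJ : ℝ := (3 + 2 * √2) / 4

/-- The external field at the critical point. -/
noncomputable def critH : ℝ := gInv critDensity - (2 * critDensity - 1) * critJ

lemma critDensity_mem : critDensity ∈ Set.Ioo (0 : ℝ) 1 := by
  have h2 : √2 ^ 2 = 2 := Real.sq_sqrt (by norm_num)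
  have h0 := Real.sqrt_nonneg 2
  constructor <;> unfold critDensity <;> nlinarith

lemma critJ_pos : 0 < critJ := by
  have h0 := Real.sqrt_nonneg 2
  unfold critJ
  linarith

/-- This identity explains the critical constants: 2 `critJ` is the minimum of `gInvDeriv`, attained
only at `critDensity`, and the excess is exactly quadratic up to the factor 1/(m(1-m)). That factor
later gives the quartic coefficient. -/
lemma gInvDeriv_sub_critJ {m : ℝ} (hm : m ∈ Set.Ioo (0 : ℝ) 1) :
    gInvDeriv m - 2 * critJ = 2 * critJ * (m - critDensity) ^ 2 / (m * (1 - m)) := by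
  have h2 : √2 ^ 2 = 2 := Real.sq_sqrt (by norm_num)
  have ha := hm.1.ne'
  have hb : 1 - m ≠ 0 := (sub_pos.2 hm.2).ne'
  unfold gInvDeriv critJ critDensity
  field_simp
  linear_combination (20 - 16 * m - 8 * √2) * h2

lemma two_critJ_lt_gInvDeriv {m : ℝ} (hm : m ∈ Set.Ioo (0 : ℝ) 1) (hne : m ≠ critDensity) :
    2 * critJ < gInvDeriv m := by
  have h1 := gInvDeriv_sub_critJ hm
  have ha := hm.1
  have hb : 0 < 1 - m := sub_pos.2 hm.2
  have hc := critJ_pos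
  have hd : 0 < (m - critDensity) ^ 2 := by
    have := sub_ne_zero.2 hne
    positivity
  have : 0 < 2 * critJ * (m - critDensity) ^ 2 / (m * (1 - m)) := by positivity
  linarith

lemma gInvDeriv_critDensity : gInvDeriv critDensity = 2 * critJ := by
  have h1 := gInvDeriv_sub_critJ critDensity_mem
  simp at h1
  linarith

/-- The sign is governed by 2(1-a)(1-b) - ab, which decreases in a and b and vanishes at a = b =
`critDensity` by `critDensity_sq`. Monotonicity on each side of `critDensity` follows. -/
lemma gInvDeriv_sub {a b : ℝ} (ha : a ∈ Set.Ioo (0 : ℝ) 1) (hb : b ∈ Set.Ioo (0 : ℝ) 1) :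
    gInvDeriv a - gInvDeriv b =
      (b - a) * (2 * ((1 - a) * (1 - b)) - a * b) / (2 * (a * b * ((1 - a) * (1 - b)))) := by
  have ha1 := ha.1.ne'
  have hb1 := hb.1.ne'
  have ha2 : 1 - a ≠ 0 := (sub_pos.2 ha.2).ne'
  have hb2 : 1 - b ≠ 0 := (sub_pos.2 hb.2).ne'
  unfold gInvDeriv
  field_simp
  ring

lemma critDensity_sq : critDensity ^ 2 = 2 * (1 - critDensity) ^ 2 := by
  have h2 : √2 ^ 2 = 2 := Real.sq_sqrt (by norm_num)
  unfold critDensity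
  linear_combination -h2

lemma gInvDeriv_lt_of_lt_critDensity {a b : ℝ} (ha : 0 < a) (hab : a < b)
    (hb : b ≤ critDensity) : gInvDeriv b < gInvDeriv a := by
  have hc := critDensity_mem
  have hbm : b ∈ Set.Ioo (0 : ℝ) 1 := ⟨ha.trans hab, hb.trans_lt hc.2⟩
  have ham : a ∈ Set.Ioo (0 : ℝ) 1 := ⟨ha, hab.trans hbm.2⟩
  have h1 := gInvDeriv_sub ham hbm
  have ha2 : 0 < 1 - a := sub_pos.2 ham.2
  have hb1 := hbm.1
  have hb2 : 0 < 1 - b := sub_pos.2 hbm.2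
  have h2 : a * b < critDensity ^ 2 := by nlinarith [hc.1]
  have h3 : (1 - critDensity) ^ 2 ≤ (1 - a) * (1 - b) := by
    have : 0 < 1 - critDensity := sub_pos.2 hc.2
    nlinarith
  have h4 := critDensity_sq
  have h5 : 0 < 2 * ((1 - a) * (1 - b)) - a * b := by linarith
  have h6 : 0 < b - a := sub_pos.2 hab
  have : 0 < gInvDeriv a - gInvDeriv b := by rw [h1]; positivity
  linarith

lemma gInvDeriv_lt_of_critDensity_lt {a b : ℝ} (ha : critDensity ≤ a) (hab : a < b)
    (hb : b < 1) : gInvDeriv a < gInvDeriv b := by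
  have hc := critDensity_mem
  have ham : a ∈ Set.Ioo (0 : ℝ) 1 := ⟨hc.1.trans_le ha, hab.trans hb⟩
  have hbm : b ∈ Set.Ioo (0 : ℝ) 1 := ⟨ham.1.trans hab, hb⟩
  have h1 := gInvDeriv_sub hbm ham
  have ha1 := ham.1
  have ha2 : 0 < 1 - a := sub_pos.2 ham.2
  have hb1 := hbm.1
  have hb2 : 0 < 1 - b := sub_pos.2 hbm.2
  have h2 : critDensity ^ 2 < a * b := by nlinarith [hc.1]
  have h3 : (1 - b) * (1 - a) ≤ (1 - critDensity) ^ 2 := by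
    have : 0 < 1 - critDensity := sub_pos.2 hc.2
    nlinarith
  have h4 := critDensity_sq
  have h5 : 0 < b * a - 2 * ((1 - b) * (1 - a)) := by linarith
  have h6 : 0 < b - a := sub_pos.2 hab
  have h7 : 0 < gInvDeriv b - gInvDeriv a := by
    rw [h1, show (a - b) * (2 * ((1 - b) * (1 - a)) - b * a) =
      (b - a) * (b * a - 2 * ((1 - b) * (1 - a))) by ring]
    positivity
  linarith

lemma strictMonoOn_rateDeriv {h J a b : ℝ} (ha : 0 < a) (hb : b < 1)
    (hD : ∀ x ∈ Set.Ioo a b, gInvDeriv x < 2 * J) : StrictMonoOn (rateDeriv h J) (Set.Icc a b) := by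
  have hmem : ∀ x ∈ Set.Icc a b, x ∈ Set.Ioo (0 : ℝ) 1 := fun x hx =>
    ⟨ha.trans_le hx.1, hx.2.trans_lt hb⟩
  refine strictMonoOn_of_deriv_pos (convex_Icc a b)
    (fun x hx => (hasDerivAt_rateDeriv h J (hmem x hx)).continuousAt.continuousWithinAt) ?_
  intro x hx
  rw [interior_Icc] at hx
  rw [(hasDerivAt_rateDeriv h J (hmem x (Set.Ioo_subset_Icc_self hx))).deriv]
  linarith [hD x hx]

lemma strictAntiOn_rateDeriv {h J a b : ℝ} (ha : 0 < a) (hb : b < 1)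
    (hD : ∀ x ∈ Set.Ioo a b, 2 * J < gInvDeriv x) : StrictAntiOn (rateDeriv h J) (Set.Icc a b) := by
  have hmem : ∀ x ∈ Set.Icc a b, x ∈ Set.Ioo (0 : ℝ) 1 := fun x hx =>
    ⟨ha.trans_le hx.1, hx.2.trans_lt hb⟩
  refine strictAntiOn_of_deriv_neg (convex_Icc a b)
    (fun x hx => (hasDerivAt_rateDeriv h J (hmem x hx)).continuousAt.continuousWithinAt) ?_
  intro x hx
  rw [interior_Icc] at hx
  rw [(hasDerivAt_rateDeriv h J (hmem x (Set.Ioo_subset_Icc_self hx))).deriv]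
  linarith [hD x hx]

/-- The rate is strictly convex on the interval with zero slope at the left end, so it increases.
This and its mirror image rule out candidate maximum points. -/
lemma rate_lt_right {h J a b : ℝ} (ha : 0 < a) (hab : a < b) (hb : b < 1)
    (h0 : rateDeriv h J a = 0) (hD : ∀ x ∈ Set.Ioo a b, gInvDeriv x < 2 * J) :
    rate h J a < rate h J b := by
  have hmem : ∀ x ∈ Set.Icc a b, x ∈ Set.Ioo (0 : ℝ) 1 := fun x hx =>
    ⟨ha.trans_le hx.1, hx.2.trans_lt hb⟩
  have hmono := strictMonoOn_rateDeriv (h := h) ha hb hD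
  refine strictMonoOn_of_deriv_pos (convex_Icc a b) (continuous_rate h J).continuousOn ?_
    (Set.left_mem_Icc.2 hab.le) (Set.right_mem_Icc.2 hab.le) hab
  intro x hx
  rw [interior_Icc] at hx
  have hx' := Set.Ioo_subset_Icc_self hx
  rw [(hasDerivAt_rate h J (hmem x hx')).deriv, ← h0]
  exact hmono (Set.left_mem_Icc.2 hab.le) hx' hx.1

lemma rate_lt_left {h J a b : ℝ} (ha : 0 < a) (hab : a < b) (hb : b < 1)
    (h0 : rateDeriv h J b = 0) (hD : ∀ x ∈ Set.Ioo a b, gInvDeriv x < 2 * J) :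
    rate h J b < rate h J a := by
  have hmem : ∀ x ∈ Set.Icc a b, x ∈ Set.Ioo (0 : ℝ) 1 := fun x hx =>
    ⟨ha.trans_le hx.1, hx.2.trans_lt hb⟩
  have hmono := strictMonoOn_rateDeriv (h := h) ha hb hD
  refine strictAntiOn_of_deriv_neg (convex_Icc a b) (continuous_rate h J).continuousOn ?_
    (Set.left_mem_Icc.2 hab.le) (Set.right_mem_Icc.2 hab.le) hab
  intro x hx
  rw [interior_Icc] at hx
  have hx' := Set.Ioo_subset_Icc_self hx
  rw [(hasDerivAt_rate h J (hmem x hx')).deriv, ← h0]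
  exact hmono hx' (Set.right_mem_Icc.2 hab.le) hx.2

/-! ### Global maximum points and their nondegeneracy -/

lemma IsGlobalMax.g_effField {h J m : ℝ} (hJ : 0 < J)
    (hm : IsGlobalMax (variationalPressure h J) m) : g (effField h J m) = m := by
  have h1 : IsLocalMax (variationalPressure h J) m := Eventually.of_forall hm
  have h2 := h1.hasDerivAt_eq_zero (hasDerivAt_variationalPressure h J m)
  have h3 : 2 * J ≠ 0 := by positivity
  have := (mul_eq_zero.1 h2).resolve_left h3
  linarith

lemma IsGlobalMax.mem_Ioo {h J m : ℝ} (hJ : 0 < J)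
    (hm : IsGlobalMax (variationalPressure h J) m) : m ∈ Set.Ioo (0 : ℝ) 1 :=
  hm.g_effField hJ ▸ g_mem _

lemma IsGlobalMax.rateDeriv_eq_zero {h J m : ℝ} (hJ : 0 < J)
    (hm : IsGlobalMax (variationalPressure h J) m) : rateDeriv h J m = 0 := by
  have h1 := gInv_g (effField h J m)
  rw [hm.g_effField hJ] at h1
  rw [rateDeriv, h1, sub_self]

lemma IsGlobalMax.rate_le {h J m x : ℝ} (hJ : 0 < J)
    (hm : IsGlobalMax (variationalPressure h J) m) (hx : x ∈ Set.Icc (0 : ℝ) 1) :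
    rate h J x ≤ rate h J m :=
  (rate_le_variationalPressure h J hx).trans
    ((hm x).trans_eq (rate_eq_variationalPressure (hm.g_effField hJ)).symm)

/-- If the rate at x were at least the rate at m, the pressure at x would be at least the pressure
at m, making x a second global maximum point. -/
lemma IsUniqueGlobalMax.rate_lt {h J m x : ℝ} (hJ : 0 < J)
    (hm : IsUniqueGlobalMax (variationalPressure h J) m) (hx : x ∈ Set.Icc (0 : ℝ) 1)
    (hne : x ≠ m) : rate h J x < rate h J m := by
  by_contra! hle
  refine hne (hm.2 x fun y => (hm.1 y).trans ?_)
  rw [← rate_eq_variationalPressure (hm.1.g_effField hJ)]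
  exact hle.trans (rate_le_variationalPressure h J hx)

/-- Since 0 < g < 1, the pressure increases on the left of 0 and decreases on the right of 1, so a
maximum over [0,1] is global. -/
lemma exists_isGlobalMax (h : ℝ) {J : ℝ} (hJ : 0 < J) :
    ∃ m, IsGlobalMax (variationalPressure h J) m := by
  obtain ⟨m, -, hm⟩ := isCompact_Icc.exists_isMaxOn (Set.nonempty_Icc.2 zero_le_one)
    (continuous_variationalPressure h J).continuousOn
  rw [isMaxOn_iff] at hm
  have hc : ∀ s, ContinuousOn (variationalPressure h J) s := fun s =>
    (continuous_variationalPressure h J).continuousOn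
  refine ⟨m, fun x => ?_⟩
  rcases le_total x 0 with hx | hx
  · refine le_trans ?_ (hm 0 (by simp))
    refine monotoneOn_of_deriv_nonneg (convex_Iic 0) (hc _)
      (fun y _ => (hasDerivAt_variationalPressure h J y).differentiableAt.differentiableWithinAt)
      (fun y hy => ?_) hx (Set.mem_Iic.2 le_rfl) hx
    rw [(hasDerivAt_variationalPressure h J y).deriv]
    rw [interior_Iic] at hy
    have := g_pos (effField h J y)
    exact mul_nonneg (by positivity) (by linarith [Set.mem_Iio.1 hy])
  rcases le_total x 1 with hx1 | hx1
  · exact hm x ⟨hx, hx1⟩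
  · refine le_trans ?_ (hm 1 (by simp))
    refine antitoneOn_of_deriv_nonpos (convex_Ici 1) (hc _)
      (fun y _ => (hasDerivAt_variationalPressure h J y).differentiableAt.differentiableWithinAt)
      (fun y hy => ?_) (Set.mem_Ici.2 le_rfl) hx1 hx1
    rw [(hasDerivAt_variationalPressure h J y).deriv]
    rw [interior_Ici] at hy
    have := g_lt_one (effField h J y)
    exact mul_nonpos_of_nonneg_of_nonpos (by positivity) (by linarith [Set.mem_Ioi.1 hy])

/-- Otherwise `gInvDeriv`, being monotone towards `critDensity`, stays below 2J between m and
`critDensity`. The rate is then strictly convex there with zero slope at m, so it is larger at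
`critDensity` than at m. -/
lemma IsGlobalMax.lt_gInvDeriv {h J m : ℝ} (hJ : 0 < J)
    (hm : IsGlobalMax (variationalPressure h J) m) (hne : m ≠ critDensity) :
    2 * J < gInvDeriv m := by
  have h0 := hm.rateDeriv_eq_zero hJ
  have hmem := hm.mem_Ioo hJ
  have hc := critDensity_mem
  by_contra! hle
  rcases hne.lt_or_gt with hlt | hlt
  · exact absurd (hm.rate_le hJ (Set.Ioo_subset_Icc_self hc))
      (rate_lt_right hmem.1 hlt hc.2 h0 fun x hx =>
        (gInvDeriv_lt_of_lt_critDensity hmem.1 hx.1 hx.2.le).trans_le hle).not_ge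
  · exact absurd (hm.rate_le hJ (Set.Ioo_subset_Icc_self hc))
      (rate_lt_left hc.1 hlt hmem.2 h0 fun x hx =>
        (gInvDeriv_lt_of_critDensity_lt hx.1.le hx.2 hmem.2).trans_le hle).not_ge

lemma continuousAt_gInvDeriv {m : ℝ} (hm : m ∈ Set.Ioo (0 : ℝ) 1) :
    ContinuousAt gInvDeriv m := by
  have ha := hm.1.ne'
  have hb : 1 - m ≠ 0 := (sub_pos.2 hm.2).ne'
  unfold gInvDeriv
  fun_prop (disch := assumption)

/-- For J > `critJ` the rate is strictly convex near `critDensity`, so a critical point there is not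
a maximum. -/
lemma IsGlobalMax.le_critJ {h J : ℝ} (hJ : 0 < J)
    (hm : IsGlobalMax (variationalPressure h J) critDensity) : J ≤ critJ := by
  by_contra! hlt
  have hc := critDensity_mem
  have h1 : ∀ᶠ x in 𝓝 critDensity, gInvDeriv x < 2 * J ∧ x < 1 :=
    ((continuousAt_gInvDeriv hc).eventually_lt_const
      (by rw [gInvDeriv_critDensity]; linarith)).and (eventually_lt_nhds hc.2)
  obtain ⟨b, hb, hsub⟩ := exists_Ico_subset_of_mem_nhds h1 (exists_gt _)
  obtain ⟨c, hc1, hc2⟩ := exists_between hb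
  have hc3 : c < 1 := (hsub ⟨hc1.le, hc2⟩).2
  exact absurd (hm.rate_le hJ ⟨(hc.1.trans hc1).le, hc3.le⟩)
    (rate_lt_right hc.1 hc1 hc3 (hm.rateDeriv_eq_zero hJ) fun x hx =>
      (hsub ⟨hx.1.le, hx.2.trans hc2⟩).1).not_ge

/-- For J ≤ `critJ` the function `rateDeriv` is strictly decreasing on (0,1): its derivative is
negative except possibly at `critDensity`. -/
lemma eq_of_rateDeriv_eq_zero {h J a b : ℝ} (ha : a ∈ Set.Ioo (0 : ℝ) 1)
    (hb : b ∈ Set.Ioo (0 : ℝ) 1) (hJ : J ≤ critJ) (ha0 : rateDeriv h J a = 0)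
    (hb0 : rateDeriv h J b = 0) : a = b := by
  have key : ∀ {x y : ℝ}, x ∈ Set.Ioo (0 : ℝ) 1 → y ∈ Set.Ioo (0 : ℝ) 1 → x < y →
      rateDeriv h J y < rateDeriv h J x := by
    intro x y hx hy hxy
    have hc := critDensity_mem
    have h1 : ∀ {u v : ℝ}, 0 < u → u < v → v < 1 → (v ≤ critDensity ∨ critDensity ≤ u) →
        rateDeriv h J v < rateDeriv h J u := by
      intro u v hu huv hv hor
      refine strictAntiOn_rateDeriv hu hv (fun z hz => ?_) (Set.left_mem_Icc.2 huv.le)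
        (Set.right_mem_Icc.2 huv.le) huv
      have hne : z ≠ critDensity := by
        rcases hor with ho | ho
        · exact (hz.2.trans_le ho).ne
        · exact (ho.trans_lt hz.1).ne'
      linarith [two_critJ_lt_gInvDeriv ⟨hu.trans hz.1, hz.2.trans hv⟩ hne]
    -- The derivative may vanish at `critDensity`, so an interval containing it in its interior is
    -- cut there.
    rcases le_or_gt y critDensity with hyc | hyc
    · exact h1 hx.1 hxy hy.2 (Or.inl hyc)
    rcases le_or_gt critDensity x with hxc | hxc
    · exact h1 hx.1 hxy hy.2 (Or.inr hxc)
    · exact (h1 hc.1 hyc hy.2 (Or.inr le_rfl)).trans (h1 hx.1 hxc hc.2 (Or.inl le_rfl))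
  rcases lt_trichotomy a b with hab | hab | hab
  · linarith [key ha hb hab]
  · exact hab
  · linarith [key hb ha hab]

lemma critJ_lt_of_mem {h J : ℝ} (hp : (h, J) ∈ coexistenceCurve) : critJ < J := by
  obtain ⟨hJ, m₁, m₂, hlt, h1, h2⟩ := hp
  simp only at hJ h1 h2
  by_contra! hle
  exact hlt.ne (eq_of_rateDeriv_eq_zero (h1.mem_Ioo hJ) (h2.mem_Ioo hJ) hle
    (h1.rateDeriv_eq_zero hJ) (h2.rateDeriv_eq_zero hJ))

/-- If both maximum points were on one side, the strict bound at the one nearer `critDensity` would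
spread by monotonicity to the whole interval between them. Then `rateDeriv` would be strictly
decreasing between two of its zeros. -/
lemma IsGlobalMax.lt_critDensity_lt {h J m₁ m₂ : ℝ} (hJ : critJ < J) (hlt : m₁ < m₂)
    (h1 : IsGlobalMax (variationalPressure h J) m₁)
    (h2 : IsGlobalMax (variationalPressure h J) m₂) : m₁ < critDensity ∧ critDensity < m₂ := by
  have hJ0 : 0 < J := critJ_pos.trans hJ
  have hn1 : m₁ ≠ critDensity := by
    rintro rfl
    exact (h1.le_critJ hJ0).not_gt hJ
  have hn2 : m₂ ≠ critDensity := by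
    rintro rfl
    exact (h2.le_critJ hJ0).not_gt hJ
  have e1 := h1.rateDeriv_eq_zero hJ0
  have e2 := h2.rateDeriv_eq_zero hJ0
  have hm1 := h1.mem_Ioo hJ0
  have hm2 := h2.mem_Ioo hJ0
  have hD1 := h1.lt_gInvDeriv hJ0 hn1
  have hD2 := h2.lt_gInvDeriv hJ0 hn2
  have key : (∀ x ∈ Set.Ioo m₁ m₂, 2 * J < gInvDeriv x) → False := fun hD => by
    have := strictAntiOn_rateDeriv (h := h) hm1.1 hm2.2 hD (Set.left_mem_Icc.2 hlt.le)
      (Set.right_mem_Icc.2 hlt.le) hlt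
    linarith
  constructor
  · by_contra! hle
    exact key fun x hx => hD1.trans (gInvDeriv_lt_of_critDensity_lt hle hx.1 (hx.2.trans hm2.2))
  · by_contra! hle
    exact key fun x hx => hD2.trans (gInvDeriv_lt_of_lt_critDensity (hm1.1.trans hx.1) hx.2 hle)

/-! ### The coexistence curve and its endpoint -/

lemma continuous_variationalPressure_uncurry :
    Continuous fun p : (ℝ × ℝ) × ℝ => variationalPressure p.1.1 p.1.2 p.2 := by
  unfold variationalPressure
  have := continuous_purePressure
  fun_prop

lemma isClosed_isGlobalMax :
    IsClosed {p : (ℝ × ℝ) × ℝ | IsGlobalMax (variationalPressure p.1.1 p.1.2) p.2} := by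
  have : {p : (ℝ × ℝ) × ℝ | IsGlobalMax (variationalPressure p.1.1 p.1.2) p.2} =
      ⋂ x : ℝ, {p | variationalPressure p.1.1 p.1.2 x ≤ variationalPressure p.1.1 p.1.2 p.2} := by
    ext p
    simp [IsGlobalMax]
  rw [this]
  refine isClosed_iInter fun x => isClosed_le ?_ continuous_variationalPressure_uncurry
  exact continuous_variationalPressure_uncurry.comp (by fun_prop : Continuous
    fun p : (ℝ × ℝ) × ℝ => (p.1, x))

/-- Projection along a compact factor is a closed map. -/
lemma isClosed_exists_isGlobalMax {K : Set ℝ} (hK : IsCompact K) :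
    IsClosed {p : ℝ × ℝ | ∃ m ∈ K, IsGlobalMax (variationalPressure p.1 p.2) m} := by
  have := isCompact_iff_compactSpace.1 hK
  have h1 : IsClosed {q : (ℝ × ℝ) × K | IsGlobalMax (variationalPressure q.1.1 q.1.2) q.2} :=
    isClosed_isGlobalMax.preimage (by fun_prop :
      Continuous fun q : (ℝ × ℝ) × K => (q.1, (q.2 : ℝ)))
  convert isClosedMap_fst_of_compactSpace _ h1 using 1
  ext p
  simp

/-- The curve lies in a closed set: some maximum point in [0, `critDensity`], some in
[`critDensity`, 1], and `critJ` ≤ J. At a point of this set, either the two are distinct, or both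
equal `critDensity`, which forces J = `critJ` and then h = `critH`. -/
lemma closure_coexistenceCurve_subset :
    closure coexistenceCurve ⊆ insert (critH, critJ) coexistenceCurve := by
  have hcl : IsClosed ({p : ℝ × ℝ | ∃ m ∈ Set.Icc 0 critDensity,
      IsGlobalMax (variationalPressure p.1 p.2) m} ∩ {p : ℝ × ℝ | ∃ m ∈ Set.Icc critDensity 1,
      IsGlobalMax (variationalPressure p.1 p.2) m} ∩ {p : ℝ × ℝ | critJ ≤ p.2}) :=
    ((isClosed_exists_isGlobalMax isCompact_Icc).inter
      (isClosed_exists_isGlobalMax isCompact_Icc)).inter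
      (isClosed_le continuous_const continuous_snd)
  refine (closure_minimal ?_ hcl).trans ?_
  · rintro ⟨h, J⟩ hp
    have hJ := critJ_lt_of_mem hp
    obtain ⟨hJ0, m₁, m₂, hlt, h1, h2⟩ := hp
    have h3 := IsGlobalMax.lt_critDensity_lt hJ hlt h1 h2
    exact ⟨⟨⟨m₁, ⟨(h1.mem_Ioo hJ0).1.le, h3.1.le⟩, h1⟩,
      ⟨m₂, ⟨h3.2.le, (h2.mem_Ioo hJ0).2.le⟩, h2⟩⟩, hJ.le⟩
  · rintro ⟨h, J⟩ ⟨⟨⟨m₁, hm1, h1⟩, ⟨m₂, hm2, h2⟩⟩, hJ⟩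
    simp only [Set.mem_ofPred_eq] at h1 h2 hJ
    have hJ0 : 0 < J := critJ_pos.trans_le hJ
    rcases (hm1.2.trans hm2.1).eq_or_lt with heq | hlt
    · left
      have hm : m₁ = critDensity := le_antisymm hm1.2 (heq ▸ hm2.1)
      subst hm
      have hJc : J = critJ := le_antisymm (h1.le_critJ hJ0) hJ
      subst hJc
      have := h1.rateDeriv_eq_zero hJ0
      unfold rateDeriv effField at this
      have hh : h = critH := by unfold critH; linarith
      rw [hh]
    · exact Or.inr ⟨hJ0, m₁, m₂, hlt, h1, h2⟩

/-- For fixed J, the values h having a maximum point in the left half and those having one in the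
right half form two closed sets covering the line. Both are nonempty (take h very negative or very
positive), so they meet by connectedness. The bound on h supplies the compactness used in
`crit_mem_closure`. -/
lemma exists_mem_coexistenceCurve {J : ℝ} (hJ : critJ < J) :
    ∃ h, |h| ≤ |gInv critDensity| + J ∧ (h, J) ∈ coexistenceCurve := by
  have hJ0 : 0 < J := critJ_pos.trans hJ
  have hc := critDensity_mem
  have hcont : Continuous fun h : ℝ => (h, J) := by fun_prop
  have hA := (isClosed_exists_isGlobalMax
    (isCompact_Icc (a := (0 : ℝ)) (b := critDensity))).preimage hcont
  have hB := (isClosed_exists_isGlobalMax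
    (isCompact_Icc (a := critDensity) (b := (1 : ℝ)))).preimage hcont
  have hbelow : ∀ {h m : ℝ}, IsGlobalMax (variationalPressure h J) m → m ≤ critDensity →
      h ≤ gInv critDensity + J := by
    intro h m hm hle
    have h0 := hm.rateDeriv_eq_zero hJ0
    have hmem := hm.mem_Ioo hJ0
    have h1 := strictMonoOn_gInv.monotoneOn hmem hc hle
    unfold rateDeriv effField at h0
    nlinarith [hmem.1]
  have habove : ∀ {h m : ℝ}, IsGlobalMax (variationalPressure h J) m → critDensity ≤ m →
      gInv critDensity - J ≤ h := by
    intro h m hm hle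
    have h0 := hm.rateDeriv_eq_zero hJ0
    have hmem := hm.mem_Ioo hJ0
    have h1 := strictMonoOn_gInv.monotoneOn hc hmem hle
    unfold rateDeriv effField at h0
    nlinarith [hmem.2]
  have hcover : ∀ h : ℝ, (∃ m ∈ Set.Icc 0 critDensity, IsGlobalMax (variationalPressure h J) m) ∨
      ∃ m ∈ Set.Icc critDensity 1, IsGlobalMax (variationalPressure h J) m := by
    intro h
    obtain ⟨m, hm⟩ := exists_isGlobalMax h hJ0
    have hmem := hm.mem_Ioo hJ0
    rcases le_total m critDensity with hle | hle
    · exact Or.inl ⟨m, ⟨hmem.1.le, hle⟩, hm⟩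
    · exact Or.inr ⟨m, ⟨hle, hmem.2.le⟩, hm⟩
  obtain ⟨h, -, ⟨m₁, hm1, h1⟩, ⟨m₂, hm2, h2⟩⟩ := isPreconnected_closed_iff.1
    (isPreconnected_univ (α := ℝ)) _ _ hA hB (fun h _ => hcover h)
    ⟨gInv critDensity - J - 1, trivial, (hcover _).resolve_right fun ⟨m, hm, hmax⟩ => by
      linarith [habove hmax hm.1]⟩
    ⟨gInv critDensity + J + 1, trivial, (hcover _).resolve_left fun ⟨m, hm, hmax⟩ => by
      linarith [hbelow hmax hm.2]⟩
  simp only at h1 h2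
  refine ⟨h, ?_, hJ0, m₁, m₂, ?_, h1, h2⟩
  · have := hbelow h1 hm1.2
    have := habove h2 hm2.1
    have := le_abs_self (gInv critDensity)
    have := neg_abs_le (gInv critDensity)
    exact abs_le.2 ⟨by linarith, by linarith⟩
  · refine lt_of_le_of_ne (hm1.2.trans hm2.1) fun heq => ?_
    have hm : m₁ = critDensity := le_antisymm hm1.2 (heq ▸ hm2.1)
    subst hm
    exact (h1.le_critJ hJ0).not_gt hJ

lemma crit_notMem_coexistenceCurve (h : ℝ) : (h, critJ) ∉ coexistenceCurve := fun hp =>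
  (critJ_lt_of_mem hp).false

/-- Along J decreasing to `critJ`, the coexistence fields h stay bounded. A subsequential limit lies
in the closure but, having J = `critJ`, not on the curve, so it can only be the critical point. -/
lemma crit_mem_closure : (critH, critJ) ∈ closure coexistenceCurve := by
  have hlt : ∀ n : ℕ, critJ < critJ + 1 / ((n : ℝ) + 1) := fun n => by
    have : (0 : ℝ) < 1 / ((n : ℝ) + 1) := by positivity
    linarith
  choose u hu hmem using fun n : ℕ => exists_mem_coexistenceCurve (hlt n)
  have hbd : ∀ n, u n ∈ Metric.closedBall (0 : ℝ) (|gInv critDensity| + (critJ + 1)) := by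
    intro n
    rw [mem_closedBall_zero_iff, Real.norm_eq_abs]
    have : 1 / ((n : ℝ) + 1) ≤ 1 := by
      rw [div_le_one (by positivity)]
      linarith [n.cast_nonneg (α := ℝ)]
    linarith [hu n]
  obtain ⟨h, -, φ, hφ, hlim⟩ := (isCompact_closedBall _ _).tendsto_subseq hbd
  have hJlim : Tendsto (fun n => critJ + 1 / ((φ n : ℝ) + 1)) atTop (𝓝 critJ) := by
    have := (tendsto_one_div_add_atTop_nhds_zero_nat (𝕜 := ℝ)).comp hφ.tendsto_atTop
    simpa using this.const_add critJ
  have hcl : (h, critJ) ∈ closure coexistenceCurve :=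
    mem_closure_of_tendsto (hlim.prodMk_nhds hJlim) (Eventually.of_forall fun n => hmem (φ n))
  have := (closure_coexistenceCurve_subset hcl).resolve_right (crit_notMem_coexistenceCurve h)
  rwa [← this]

theorem closure_diff_coexistenceCurve :
    closure coexistenceCurve \ coexistenceCurve = {(critH, critJ)} := by
  ext p
  constructor
  · rintro ⟨h1, h2⟩
    exact (closure_coexistenceCurve_subset h1).resolve_right h2
  · rintro rfl
    exact ⟨crit_mem_closure, crit_notMem_coexistenceCurve _⟩

lemma exists_isUniqueGlobalMax {h J : ℝ} (hJ : 0 < J) (hp : (h, J) ∉ coexistenceCurve) :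
    ∃ m, IsUniqueGlobalMax (variationalPressure h J) m := by
  obtain ⟨m, hm⟩ := exists_isGlobalMax h hJ
  refine ⟨m, hm, fun x hx => ?_⟩
  by_contra hne
  rcases lt_or_gt_of_ne hne with hlt | hlt
  · exact hp ⟨hJ, x, m, hlt, hx, hm⟩
  · exact hp ⟨hJ, m, x, hlt, hm, hx⟩

lemma lt_gInvDeriv_of_ne_crit {h J m : ℝ} (hJ : 0 < J) (hne : (h, J) ≠ (critH, critJ))
    (hm : IsGlobalMax (variationalPressure h J) m) : 2 * J < gInvDeriv m := by
  by_cases hmc : m = critDensity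
  · subst hmc
    rcases (hm.le_critJ hJ).lt_or_eq with hlt | heq
    · rw [gInvDeriv_critDensity]
      linarith
    · subst heq
      have := hm.rateDeriv_eq_zero hJ
      unfold rateDeriv effField at this
      have hh : h = critH := by unfold critH; linarith
      exact absurd (by rw [hh]) hne
  · exact hm.lt_gInvDeriv hJ hmc

lemma isUniqueGlobalMax_crit :
    IsUniqueGlobalMax (variationalPressure critH critJ) critDensity := by
  obtain ⟨m, hm⟩ := exists_isUniqueGlobalMax critJ_pos (crit_notMem_coexistenceCurve critH)
  have h0 : rateDeriv critH critJ critDensity = 0 := by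
    unfold rateDeriv effField critH
    ring
  have := eq_of_rateDeriv_eq_zero (hm.1.mem_Ioo critJ_pos) critDensity_mem le_rfl
    (hm.1.rateDeriv_eq_zero critJ_pos) h0
  rwa [← this]

/-! ### Derivatives of the variational pressure up to order four -/

/-- The derivative of `g` as a function of the value of `g`. -/
noncomputable def gSlope (t : ℝ) : ℝ := 2 * t + 2 - 4 / (2 - t)

/-- `gSlope` is the partial-fraction form of 2t(1-t)/(2-t), chosen because it is easy to
differentiate repeatedly. -/
lemma inv_gInvDeriv {t : ℝ} (ht : t ∈ Set.Ioo (0 : ℝ) 1) : (gInvDeriv t)⁻¹ = gSlope t := by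
  have ha := ht.1.ne'
  have hb : 1 - t ≠ 0 := (sub_pos.2 ht.2).ne'
  have hc : 2 - t ≠ 0 := by linarith [ht.2]
  refine inv_eq_of_mul_eq_one_right ?_
  unfold gSlope gInvDeriv
  field_simp
  ring

lemma hasDerivAt_g_effField (h J m : ℝ) :
    HasDerivAt (fun m => g (effField h J m)) (2 * J * gSlope (g (effField h J m))) m := by
  have := (hasDerivAt_g (effField h J m)).comp m (hasDerivAt_effField h J m)
  rw [inv_gInvDeriv (g_mem _), mul_comm] at this
  exact this

lemma hasDerivAt_gSlope {t : ℝ} (ht : t < 1) : HasDerivAt gSlope (2 - 4 / (2 - t) ^ 2) t := by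
  have hc : 2 - t ≠ 0 := by linarith
  have h1 := ((hasDerivAt_id t).const_mul 2).add_const 2
  have h2 := (hasDerivAt_const t (4 : ℝ)).div ((hasDerivAt_id t).const_sub 2) hc
  convert! h1.sub h2 using 1
  simp

lemma hasDerivAt_deriv_gSlope {t : ℝ} (ht : t < 1) :
    HasDerivAt (fun t : ℝ => 2 - 4 / (2 - t) ^ 2) (-8 / (2 - t) ^ 3) t := by
  have hc : 2 - t ≠ 0 := by linarith
  have h2 := ((hasDerivAt_const t (4 : ℝ)).div (((hasDerivAt_id t).const_sub 2).pow 2)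
    (pow_ne_zero 2 hc)).const_sub 2
  convert! h2 using 1
  simp
  field_simp
  norm_num

lemma deriv_variationalPressure (h J : ℝ) : deriv (variationalPressure h J) =
    fun m => 2 * J * (g (effField h J m) - m) :=
  funext fun m => (hasDerivAt_variationalPressure h J m).deriv

lemma iteratedDeriv_two_variationalPressure (h J : ℝ) :
    iteratedDeriv 2 (variationalPressure h J) =
      fun m => 2 * J * (2 * J * gSlope (g (effField h J m)) - 1) := by
  rw [iteratedDeriv_succ, iteratedDeriv_one, deriv_variationalPressure]
  exact funext fun m => (((hasDerivAt_g_effField h J m).sub (hasDerivAt_id m)).const_mul _).deriv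

lemma iteratedDeriv_three_variationalPressure (h J : ℝ) :
    iteratedDeriv 3 (variationalPressure h J) = fun m => (2 * J) ^ 3 *
      ((2 - 4 / (2 - g (effField h J m)) ^ 2) * gSlope (g (effField h J m))) := by
  rw [iteratedDeriv_succ, iteratedDeriv_two_variationalPressure]
  funext m
  have h1 := (hasDerivAt_gSlope (g_lt_one (effField h J m))).comp m (hasDerivAt_g_effField h J m)
  have h2 := ((h1.const_mul (2 * J)).sub_const 1).const_mul (2 * J)
  exact h2.deriv.trans (by ring)

lemma iteratedDeriv_four_variationalPressure (h J m : ℝ) :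
    iteratedDeriv 4 (variationalPressure h J) m = (2 * J) ^ 4 *
      ((-8 / (2 - g (effField h J m)) ^ 3 * gSlope (g (effField h J m)) +
        (2 - 4 / (2 - g (effField h J m)) ^ 2) ^ 2) * gSlope (g (effField h J m))) := by
  rw [iteratedDeriv_succ, iteratedDeriv_three_variationalPressure]
  have h0 := hasDerivAt_g_effField h J m
  have h1 := (hasDerivAt_gSlope (g_lt_one (effField h J m))).comp m h0
  have h2 := (hasDerivAt_deriv_gSlope (g_lt_one (effField h J m))).comp m h0
  exact ((h2.mul h1).const_mul ((2 * J) ^ 3)).deriv.trans (by simp only [Function.comp]; ring)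

lemma IsGlobalMax.iteratedDeriv_two {h J m : ℝ} (hJ : 0 < J)
    (hm : IsGlobalMax (variationalPressure h J) m) :
    iteratedDeriv 2 (variationalPressure h J) m = 2 * J * (2 * J * (gInvDeriv m)⁻¹ - 1) := by
  rw [iteratedDeriv_two_variationalPressure]
  simp only [hm.g_effField hJ, inv_gInvDeriv (hm.mem_Ioo hJ)]

lemma iteratedDeriv_four_crit :
    iteratedDeriv 4 (variationalPressure critH critJ) critDensity =
      -(4 * critJ / (critDensity * (1 - critDensity))) := by
  have hs : √2 ^ 2 = 2 := Real.sq_sqrt (by norm_num)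
  have hm := critDensity_mem
  rw [iteratedDeriv_four_variationalPressure, isUniqueGlobalMax_crit.1.g_effField critJ_pos,
    ← inv_gInvDeriv hm, gInvDeriv_critDensity]
  have h0 : 2 - critDensity = √2 := by unfold critDensity; ring
  have hc := critJ_pos
  have ha := hm.1.ne'
  have hb : 1 - critDensity ≠ 0 := (sub_pos.2 hm.2).ne'
  -- Since 2 - `critDensity` = √2, the factor 2 - 4/(2-t)² vanishes and only one term of the fourth
  -- derivative survives.
  rw [h0, hs, show √2 ^ 3 = 2 * √2 by rw [pow_succ, hs]]
  have h1 : critJ * (critDensity * (1 - critDensity)) = √2 / 4 := by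
    unfold critJ critDensity
    linear_combination (3 / 4 - √2 / 2) * hs
  have hd : 4 * critJ / (critDensity * (1 - critDensity)) = 16 * critJ ^ 2 / √2 := by
    field_simp
    linear_combination (-16 : ℝ) * h1
  rw [hd]
  field_simp
  norm_num

/-! ### Leading order of the rate function at its maximum -/

lemma tendsto_div_pow_succ_of_deriv {u u' : ℝ → ℝ} {a c : ℝ} (n : ℕ)
    (hu : ∀ᶠ y in 𝓝 a, HasDerivAt u (u' y) y) (h0 : u a = 0)
    (h : Tendsto (fun y => u' y / (y - a) ^ n) (𝓝[≠] a) (𝓝 c)) :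
    Tendsto (fun y => u y / (y - a) ^ (n + 1)) (𝓝[≠] a) (𝓝 (c / (n + 1))) := by
  -- One L'Hôpital step raises the order of vanishing by one; iterating it gives leading Taylor
  -- coefficients.
  refine HasDerivAt.lhopital_zero_nhdsNE (f' := u')
    (g' := fun y => (n + 1 : ℝ) * (y - a) ^ n) (hu.filter_mono nhdsWithin_le_nhds)
    (Eventually.of_forall fun y => ?_) ?_ ?_ ?_ ?_
  · convert! ((hasDerivAt_id y).sub_const a).pow (n + 1) using 1
    simp
  · filter_upwards [self_mem_nhdsWithin] with y hy
    have : y - a ≠ 0 := sub_ne_zero.2 hy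
    positivity
  · have := hu.self_of_nhds.continuousAt.tendsto
    rw [h0] at this
    exact this.mono_left nhdsWithin_le_nhds
  · have : Tendsto (fun y : ℝ => (y - a) ^ (n + 1)) (𝓝 a) (𝓝 ((a - a) ^ (n + 1))) :=
      Continuous.tendsto (by fun_prop) a
    rw [sub_self, zero_pow n.succ_ne_zero] at this
    exact this.mono_left nhdsWithin_le_nhds
  · refine (h.div_const _).congr fun y => ?_
    rw [div_div, mul_comm]

lemma tendsto_rate_div_sq {h J m : ℝ} (hm : m ∈ Set.Ioo (0 : ℝ) 1) (h0 : rateDeriv h J m = 0) :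
    Tendsto (fun y => (rate h J y - rate h J m) / (y - m) ^ 2) (𝓝[≠] m)
      (𝓝 (-((gInvDeriv m - 2 * J) / 2))) := by
  have h1 := (hasDerivAt_rateDeriv h J hm).tendsto_slope
  have h2 : Tendsto (fun y => rateDeriv h J y / (y - m) ^ 1) (𝓝[≠] m)
      (𝓝 (2 * J - gInvDeriv m)) := by
    refine h1.congr fun y => ?_
    rw [slope_def_field, h0, sub_zero, pow_one]
  have h3 := tendsto_div_pow_succ_of_deriv (u := fun y => rate h J y - rate h J m) 1
    ((isOpen_Ioo.eventually_mem hm).mono fun y hy => (hasDerivAt_rate h J hy).sub_const _)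
    (sub_self _) h2
  convert h3 using 2
  push_cast
  ring

/-- By `gInvDeriv_sub_critJ` the second derivative of the rate vanishes exactly quadratically at
`critDensity`; two L'Hôpital steps divide its coefficient by 3 and by 4. -/
lemma tendsto_rate_crit_div_pow_four :
    Tendsto (fun y => (rate critH critJ y - rate critH critJ critDensity) / (y - critDensity) ^ 4)
      (𝓝[≠] critDensity) (𝓝 (-(critJ / (6 * (critDensity * (1 - critDensity)))))) := by
  have hm := critDensity_mem
  have ha := hm.1.ne'
  have hb : 1 - critDensity ≠ 0 := (sub_pos.2 hm.2).ne'
  have h0 := isUniqueGlobalMax_crit.1.rateDeriv_eq_zero critJ_pos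
  have hev := isOpen_Ioo.eventually_mem hm
  have h1 : Tendsto (fun y => (2 * critJ - gInvDeriv y) / (y - critDensity) ^ 2)
      (𝓝[≠] critDensity) (𝓝 (-(2 * critJ / (critDensity * (1 - critDensity))))) := by
    have : ContinuousAt (fun y : ℝ => -(2 * critJ / (y * (1 - y)))) critDensity := by
      fun_prop (disch := simp [ha, hb])
    refine (this.tendsto.mono_left nhdsWithin_le_nhds).congr' ?_
    filter_upwards [self_mem_nhdsWithin, hev.filter_mono nhdsWithin_le_nhds] with y hy hy'
    have h2 := gInvDeriv_sub_critJ hy'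
    have h3 : y - critDensity ≠ 0 := sub_ne_zero.2 hy
    rw [← neg_sub (gInvDeriv y), h2]
    field_simp
  have h2 := tendsto_div_pow_succ_of_deriv 2
    (hev.mono fun y hy => hasDerivAt_rateDeriv critH critJ hy) h0 h1
  have h3 := tendsto_div_pow_succ_of_deriv
    (u := fun y => rate critH critJ y - rate critH critJ critDensity) 3
    (hev.mono fun y hy => (hasDerivAt_rate critH critJ hy).sub_const _) (sub_self _) h2
  convert h3 using 2
  push_cast
  field_simp
  ring

/-! ### Counting dimer configurations -/

lemma IsDimerConfig.mono {V : Type*} {G : SimpleGraph V} {D D' : Finset (Sym2 V)}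
    (hD : IsDimerConfig G D) (h : D' ⊆ D) : IsDimerConfig G D' :=
  ⟨fun e he => hD.1 e (h he), fun v u u' hu hu' => hD.2 v u u' (h hu) (h hu')⟩

lemma numMonomers_add {N : ℕ} (D : Config N) : numMonomers D + 2 * D.1.card = N := by
  classical
  have hcompl : (monomers D)ᶜ = ↑(D.1.biUnion fun e => e.toFinset) := by
    ext v
    simp only [monomers, Set.mem_compl_iff, Set.mem_ofPred_eq, not_forall, not_not,
      Finset.coe_biUnion, Finset.mem_coe, Set.mem_iUnion, Sym2.mem_toFinset, exists_prop]
    constructor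
    · rintro ⟨u, hu⟩
      exact ⟨_, hu, Sym2.mem_mk_right _ _⟩
    · rintro ⟨e, he, hv⟩
      obtain ⟨u, rfl⟩ := Sym2.mem_iff_exists.1 hv
      exact ⟨u, Sym2.eq_swap ▸ he⟩
  have hdisj : ∀ e ∈ D.1, ∀ e' ∈ D.1, e ≠ e' → Disjoint e.toFinset e'.toFinset := by
    intro e he e' he' hne
    rw [Finset.disjoint_left]
    intro v hv hv'
    rw [Sym2.mem_toFinset] at hv hv'
    obtain ⟨u, rfl⟩ := Sym2.mem_iff_exists.1 hv
    obtain ⟨u', rfl⟩ := Sym2.mem_iff_exists.1 hv'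
    refine hne ?_
    rw [D.2.2 v u u' (Sym2.eq_swap ▸ he) (Sym2.eq_swap ▸ he')]
  have hcard : (D.1.biUnion fun e => e.toFinset).card = 2 * D.1.card := by
    rw [Finset.card_biUnion hdisj, Finset.sum_const_nat (m := 2), mul_comm]
    intro e he
    exact Sym2.card_toFinset_of_not_isDiag e (SimpleGraph.not_isDiag_of_mem_edgeSet _ (D.2.1 e he))
  have h1 := Set.ncard_add_ncard_compl (monomers D)
  rw [hcompl, Set.ncard_coe_finset, hcard, Nat.card_eq_fintype_card, Fintype.card_fin] at h1
  exact h1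

/-- The dimer configurations with `d` dimers on the complete graph with `N` vertices. -/
noncomputable def configsOfCard (N d : ℕ) : Finset (Config N) :=
  Finset.univ.filter fun D => D.1.card = d

lemma mem_configsOfCard {N d : ℕ} {D : Config N} : D ∈ configsOfCard N d ↔ D.1.card = d := by
  simp [configsOfCard]

open Classical in
/-- The edges joining two monomers of `D`. -/
noncomputable def freeEdges {N : ℕ} (D : Config N) : Finset (Sym2 (Fin N)) :=
  (monomers D).toFinset.offDiag.image fun p => s(p.1, p.2)

lemma mem_freeEdges {N : ℕ} {D : Config N} {u v : Fin N} :
    s(u, v) ∈ freeEdges D ↔ u ∈ monomers D ∧ v ∈ monomers D ∧ u ≠ v := by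
  classical
  simp only [freeEdges, Finset.mem_image, Finset.mem_offDiag, Set.mem_toFinset, Prod.exists,
    Sym2.eq_iff]
  constructor
  · rintro ⟨a, b, ⟨h1, h2, h3⟩, ⟨rfl, rfl⟩ | ⟨rfl, rfl⟩⟩
    · exact ⟨h1, h2, h3⟩
    · exact ⟨h2, h1, h3.symm⟩
  · rintro ⟨h1, h2, h3⟩
    exact ⟨u, v, ⟨h1, h2, h3⟩, Or.inl ⟨rfl, rfl⟩⟩

lemma card_freeEdges {N : ℕ} (D : Config N) : (freeEdges D).card = (numMonomers D).choose 2 := by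
  classical
  unfold freeEdges numMonomers
  rw [Set.ncard_eq_toFinset_card']
  exact Sym2.card_image_offDiag _

lemma notMem_of_mem_freeEdges {N : ℕ} {D : Config N} {e : Sym2 (Fin N)} (he : e ∈ freeEdges D) :
    e ∉ D.1 := by
  induction e with
  | h u v => exact (mem_freeEdges.1 he).2.1 u

lemma isDimerConfig_insert {N : ℕ} {D : Config N} {e : Sym2 (Fin N)} (he : e ∈ freeEdges D) :
    IsDimerConfig (⊤ : SimpleGraph (Fin N)) (insert e D.1) := by
  induction e with
  | h a b =>
    obtain ⟨ha, hb, hab⟩ := mem_freeEdges.1 he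
    refine ⟨fun e' he' => ?_, fun v u u' hu hu' => ?_⟩
    · rcases Finset.mem_insert.1 he' with rfl | he'
      · simpa using hab
      · exact D.2.1 e' he'
    · have hfree : ∀ {w x y : Fin N}, s(w, x) = s(a, b) → s(y, x) ∉ D.1 := by
        intro w x y hw
        rcases Sym2.eq_iff.1 hw with ⟨-, rfl⟩ | ⟨-, rfl⟩
        · exact hb y
        · exact ha y
      rcases Finset.mem_insert.1 hu with h1 | h1 <;> rcases Finset.mem_insert.1 hu' with h2 | h2
      · exact Sym2.congr_left.1 (h1.trans h2.symm)
      · exact absurd h2 (hfree h1)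
      · exact absurd h1 (hfree h2)
      · exact D.2.2 v u u' h1 h2

lemma mem_freeEdges_erase {N : ℕ} {D : Config N} {e : Sym2 (Fin N)} (he : e ∈ D.1) :
    e ∈ freeEdges (⟨D.1.erase e, D.2.mono (Finset.erase_subset _ _)⟩ : Config N) := by
  induction e with
  | h a b =>
    refine mem_freeEdges.2 ⟨fun w hw => ?_, fun w hw => ?_, ?_⟩
    · have h1 := Finset.mem_erase.1 hw
      have h2 : w = b := D.2.2 a w b h1.2 (Sym2.eq_swap ▸ he)
      exact h1.1 (h2 ▸ Sym2.eq_swap)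
    · have h1 := Finset.mem_erase.1 hw
      have h2 : w = a := D.2.2 b w a h1.2 he
      exact h1.1 (h2 ▸ rfl)
    · simpa using D.2.1 _ he

/-- Double counting: a configuration of d+1 dimers with one dimer marked is the same as a
configuration of d dimers together with an edge joining two of its N-2d monomers. -/
lemma card_configsOfCard_succ (N d : ℕ) :
    (configsOfCard N (d + 1)).card * (d + 1) =
      (configsOfCard N d).card * (N - 2 * d).choose 2 := by
  have h1 : ((configsOfCard N (d + 1)).sigma fun D => D.1).card =
      (configsOfCard N (d + 1)).card * (d + 1) := by
    rw [Finset.card_sigma, Finset.sum_const_nat fun D hD => mem_configsOfCard.1 hD]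
  have h2 : ((configsOfCard N d).sigma fun D => freeEdges D).card =
      (configsOfCard N d).card * (N - 2 * d).choose 2 := by
    rw [Finset.card_sigma, Finset.sum_const_nat fun D hD => ?_]
    have := numMonomers_add D
    rw [card_freeEdges, ← mem_configsOfCard.1 hD]
    congr 1
    omega
  rw [← h1, ← h2]
  refine Finset.card_bij'
    (fun p _ => ⟨⟨p.1.1.erase p.2, p.1.2.mono (Finset.erase_subset _ _)⟩, p.2⟩)
    (fun p hp => ⟨⟨insert p.2 p.1.1, isDimerConfig_insert (Finset.mem_sigma.1 hp).2⟩, p.2⟩)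
    ?_ ?_ ?_ ?_
  · rintro ⟨D, e⟩ hp
    obtain ⟨hD, he⟩ := Finset.mem_sigma.1 hp
    refine Finset.mem_sigma.2 ⟨mem_configsOfCard.2 ?_, mem_freeEdges_erase he⟩
    have : D.1.card = d + 1 := mem_configsOfCard.1 hD
    exact (Finset.card_erase_of_mem he).trans (congrArg (· - 1) this)
  · rintro ⟨D, e⟩ hp
    obtain ⟨hD, he⟩ := Finset.mem_sigma.1 hp
    refine Finset.mem_sigma.2 ⟨mem_configsOfCard.2 ?_, Finset.mem_insert_self _ _⟩
    simp only [Finset.card_insert_of_notMem (notMem_of_mem_freeEdges he),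
      mem_configsOfCard.1 hD]
  · rintro ⟨D, e⟩ hp
    obtain ⟨hD, he⟩ := Finset.mem_sigma.1 hp
    have : insert e (D.1.erase e) = D.1 := Finset.insert_erase he
    refine Sigma.ext (Subtype.ext this) HEq.rfl
  · rintro ⟨D, e⟩ hp
    obtain ⟨hD, he⟩ := Finset.mem_sigma.1 hp
    have : (insert e D.1).erase e = D.1 := Finset.erase_insert (notMem_of_mem_freeEdges he)
    refine Sigma.ext (Subtype.ext this) HEq.rfl

lemma card_configsOfCard_zero (N : ℕ) : (configsOfCard N 0).card = 1 := by
  rw [Finset.card_eq_one]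
  refine ⟨⟨∅, by simp [IsDimerConfig]⟩, ?_⟩
  ext D
  rw [mem_configsOfCard, Finset.card_eq_zero]
  exact ⟨fun h => Finset.mem_singleton.2 (Subtype.ext h),
    fun h => congrArg Subtype.val (Finset.mem_singleton.1 h)⟩

open Nat in
lemma card_configsOfCard_mul {N d : ℕ} (hd : 2 * d ≤ N) :
    (configsOfCard N d).card * ((N - 2 * d)! * d ! * 2 ^ d) = N ! := by
  induction d with
  | zero => simp [card_configsOfCard_zero]
  | succ d ih =>
    have h1 := ih (by omega)
    have h2 := card_configsOfCard_succ N d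
    obtain ⟨n, hn⟩ : ∃ n, N - 2 * d = n + 2 := ⟨N - 2 * d - 2, by omega⟩
    have hn' : N - 2 * (d + 1) = n := by omega
    have h4 : (n + 2).choose 2 * 2 = (n + 2) * (n + 1) := by
      have : (n + 2) * (n + 1).choose 1 = (n + 2).choose 2 * 2 :=
        Nat.add_one_mul_choose_eq (n + 1) 1
      rw [← this, Nat.choose_one_right]
    rw [hn] at h1 h2
    rw [hn', ← h1]
    calc (configsOfCard N (d + 1)).card * (n ! * (d + 1)! * 2 ^ (d + 1))
        = ((configsOfCard N (d + 1)).card * (d + 1)) * (n ! * d ! * 2 ^ d * 2) := by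
          rw [Nat.factorial_succ, pow_succ]; ring
      _ = (configsOfCard N d).card * ((n + 2).choose 2 * 2) * (n ! * d ! * 2 ^ d) := by
          rw [h2]; ring
      _ = _ := by
          rw [h4, Nat.factorial_succ, Nat.factorial_succ]; ring

/-! ### Stirling ratios and the exact law of the number of monomers -/

open Nat in
/-- The ratio of `n!` to `(n / e) ^ n`. -/
noncomputable def stirlingRatio (n : ℕ) : ℝ := n ! * Real.exp (n - n * Real.log n)

/-- The case n = 0 is exceptional: `stirlingRatio 0 = 1`, while the right-hand side is 0 because of
√0. -/
lemma stirlingRatio_eq (n : ℕ) :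
    stirlingRatio n = Stirling.stirlingSeq n * √(2 * n) ∨ n = 0 := by
  rcases Nat.eq_zero_or_pos n with rfl | hn
  · exact Or.inr rfl
  left
  have hn' : (0 : ℝ) < n := by exact_mod_cast hn
  have h1 : ((n : ℝ) / Real.exp 1) ^ n = Real.exp (-(n - n * Real.log n)) := by
    rw [← Real.exp_log (show 0 < (n : ℝ) / Real.exp 1 by positivity), ← Real.exp_nat_mul,
      Real.log_div hn'.ne' (Real.exp_pos _).ne', Real.log_exp]
    congr 1
    ring
  have h2 : √(2 * n : ℝ) ≠ 0 := by positivity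
  unfold Stirling.stirlingSeq stirlingRatio
  rw [h1, Real.exp_neg]
  field_simp

lemma one_le_stirlingRatio (n : ℕ) : 1 ≤ stirlingRatio n := by
  rcases stirlingRatio_eq n with h | rfl
  · rcases Nat.eq_zero_or_pos n with rfl | hn
    · simp [stirlingRatio]
    have hn' : (1 : ℝ) ≤ n := by exact_mod_cast hn
    rw [h]
    have h1 := Stirling.sqrt_pi_le_stirlingSeq hn.ne'
    have h2 : 1 ≤ √Real.pi := Real.one_le_sqrt.2 (by linarith [Real.pi_gt_three])
    have h3 : 1 ≤ √(2 * n : ℝ) := Real.one_le_sqrt.2 (by linarith)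
    nlinarith
  · simp [stirlingRatio]

lemma sqrt_le_stirlingRatio (n : ℕ) : √n ≤ stirlingRatio n := by
  rcases stirlingRatio_eq n with h | rfl
  · rcases Nat.eq_zero_or_pos n with rfl | hn
    · simp [stirlingRatio]
    rw [h]
    have h1 := Stirling.sqrt_pi_le_stirlingSeq hn.ne'
    have h2 : 1 ≤ √Real.pi := Real.one_le_sqrt.2 (by linarith [Real.pi_gt_three])
    have h3 : √(n : ℝ) ≤ √(2 * n : ℝ) := Real.sqrt_le_sqrt (by linarith [n.cast_nonneg (α := ℝ)])
    have h4 := Real.sqrt_nonneg (n : ℝ)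
    nlinarith
  · simp [stirlingRatio]

lemma tendsto_stirlingRatio_div_sqrt :
    Tendsto (fun n : ℕ => stirlingRatio n / √n) atTop (𝓝 (√Real.pi * √2)) := by
  refine (Stirling.tendsto_stirlingSeq_sqrt_pi.mul_const (√2)).congr' ?_
  filter_upwards [eventually_gt_atTop 0] with n hn
  have hn' : (0 : ℝ) < n := by exact_mod_cast hn
  rw [(stirlingRatio_eq n).resolve_right hn.ne', Real.sqrt_mul zero_le_two]
  have : √(n : ℝ) ≠ 0 := by positivity
  field_simp

-- The factors (n/e)^n of the three factorials combine with N^(-d), 2^(-d) and the energy into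
-- exactly exp(N · rate), leaving only the Stirling ratios.
open Nat in
lemma card_configsOfCard_mul_exp (h J : ℝ) {N d : ℕ} (hN : 0 < N) (hd : 2 * d ≤ N) :
    (configsOfCard N d).card * ((N : ℝ) ^ d)⁻¹ *
      Real.exp (N * ((h - J) * (((N - 2 * d : ℕ) : ℝ) / N) + J * (((N - 2 * d : ℕ) : ℝ) / N) ^ 2)) =
    stirlingRatio N * (Real.exp (N * rate h J (((N - 2 * d : ℕ) : ℝ) / N)) /
      (stirlingRatio (N - 2 * d) * stirlingRatio d)) := by
  set s := N - 2 * d with hs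
  have hsN : (s : ℝ) = N - 2 * d := by rw [hs]; push_cast [hd]; ring
  have hN' : (0 : ℝ) < N := by exact_mod_cast hN
  set x := (s : ℝ) / N with hx
  have hsx : (s : ℝ) = N * x := by rw [hx]; field_simp
  have h1 : ((configsOfCard N d).card : ℝ) * (s ! * d ! * 2 ^ d) = N ! := by
    exact_mod_cast card_configsOfCard_mul hd
  have h2 : (N : ℝ) ^ d = Real.exp (d * Real.log N) := by
    rw [Real.exp_nat_mul, Real.exp_log hN']
  have h3 : (2 : ℝ) ^ d = Real.exp (d * Real.log 2) := by
    rw [Real.exp_nat_mul, Real.exp_log two_pos]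
  have h4 : (s : ℝ) * Real.log s = s * (Real.log N + Real.log x) := by
    rcases Nat.eq_zero_or_pos s with h0 | h0
    · simp [h0]
    · have : (0 : ℝ) < s := by exact_mod_cast h0
      rw [hx, Real.log_div this.ne' hN'.ne']
      ring
  have hdx : (d : ℝ) = N * (1 - x) / 2 := by linarith
  have h5 : (d : ℝ) * Real.log d = d * (Real.log N + Real.log (1 - x) - Real.log 2) := by
    rcases Nat.eq_zero_or_pos d with h0 | h0
    · simp [h0]
    · have : (0 : ℝ) < d := by exact_mod_cast h0
      have hpos : 1 - x = 2 * d / N := by rw [hdx]; field_simp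
      rw [hpos, Real.log_div (by positivity) hN'.ne', Real.log_mul two_ne_zero this.ne']
      ring
  have hcard : ((configsOfCard N d).card : ℝ) = N ! / (s ! * d ! * 2 ^ d) := by
    rw [eq_div_iff (by positivity), h1]
  have hexp : Real.exp (N * rate h J x) * Real.exp (N - N * Real.log N) *
      Real.exp (d * Real.log 2) * Real.exp (d * Real.log N) =
      Real.exp (s - s * Real.log s) * Real.exp (d - d * Real.log d) *
        Real.exp (N * ((h - J) * x + J * x ^ 2)) := by
    simp only [← Real.exp_add]
    congr 1
    rw [h4, h5]
    unfold rate
    have h6 : (N : ℝ) = s + 2 * d := by linarith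
    have e1 : (N : ℝ) * (J * x ^ 2 + (h - J) * x - x * Real.log x
        - (1 - x) * Real.log (1 - x) / 2 - (1 - x) / 2) =
        N * ((h - J) * x + J * x ^ 2) - s * Real.log x - d * Real.log (1 - x) - d := by
      rw [hsx, hdx]; ring
    rw [e1]
    linear_combination (1 - Real.log N) * h6
  rw [hcard, h2, h3]
  unfold stirlingRatio
  have p1 := Real.exp_pos (s - s * Real.log s)
  have p2 := Real.exp_pos (d - d * Real.log d)
  have p3 := Real.exp_pos (d * Real.log N)
  have p4 := Real.exp_pos (d * Real.log 2)
  generalize Real.exp (s - s * Real.log s) = A at *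
  generalize Real.exp (d - d * Real.log d) = B at *
  generalize Real.exp (d * Real.log N) = C at *
  generalize Real.exp (d * Real.log 2) = E at *
  generalize Real.exp (N - N * Real.log N) = F at *
  generalize Real.exp (N * ((h - J) * x + J * x ^ 2)) = G at *
  field_simp
  linear_combination -hexp

lemma sum_gibbsWeight_mul (h J : ℝ) {N : ℕ} (hN : 0 < N) (F : ℕ → ℝ) :
    ∑ D : Config N, gibbsWeight h J D * F (numMonomers D) =
      stirlingRatio N * ∑ d ∈ Finset.range (N / 2 + 1),
        Real.exp (N * rate h J (((N - 2 * d : ℕ) : ℝ) / N)) /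
          (stirlingRatio (N - 2 * d) * stirlingRatio d) * F (N - 2 * d) := by
  have hmaps : ∀ D ∈ (Finset.univ : Finset (Config N)), D.1.card ∈ Finset.range (N / 2 + 1) := by
    intro D _
    have := numMonomers_add D
    rw [Finset.mem_range]
    omega
  rw [← Finset.sum_fiberwise_of_maps_to hmaps, Finset.mul_sum]
  refine Finset.sum_congr rfl fun d hd => ?_
  have hd' : 2 * d ≤ N := by
    have := Finset.mem_range.1 hd
    omega
  rw [← mul_assoc, ← card_configsOfCard_mul_exp h J hN hd']
  have : ∀ D ∈ Finset.univ.filter (fun D : Config N => D.1.card = d),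
      gibbsWeight h J D * F (numMonomers D) = ((N : ℝ) ^ d)⁻¹ * Real.exp (N * ((h - J) *
        (((N - 2 * d : ℕ) : ℝ) / N) + J * (((N - 2 * d : ℕ) : ℝ) / N) ^ 2)) * F (N - 2 * d) := by
    intro D hD
    have h1 := (Finset.mem_filter.1 hD).2
    have h2 : numMonomers D = N - 2 * d := by
      have := numMonomers_add D
      omega
    rw [gibbsWeight, hamiltonian, neg_neg, monomerDensity, h1, h2]
  rw [Finset.sum_congr rfl this, Finset.sum_const, nsmul_eq_mul, configsOfCard]
  ring

/-! ### Laplace's method for lattice sums -/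

lemma sum_range_eq_integral_floor (G : ℕ → ℝ) (n : ℕ) :
    ∑ d ∈ Finset.range n, G d =
      ∫ t : ℝ, (Set.Ico (0 : ℝ) n).indicator (fun t => G ⌊t⌋₊) t := by
  have hfun : (fun t : ℝ => (Set.Ico (0 : ℝ) n).indicator (fun t => G ⌊t⌋₊) t) =
      fun t => ∑ d ∈ Finset.range n, (Set.Ico (d : ℝ) (d + 1)).indicator (fun _ => G d) t := by
    funext t
    by_cases ht : t ∈ Set.Ico (0 : ℝ) n
    · rw [Set.indicator_of_mem ht, Finset.sum_eq_single_of_mem ⌊t⌋₊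
        (Finset.mem_range.2 ((Nat.floor_lt ht.1).2 ht.2))]
      · rw [Set.indicator_of_mem]
        exact ⟨Nat.floor_le ht.1, Nat.lt_floor_add_one t⟩
      · intro d _ hne
        refine Set.indicator_of_notMem (fun hd => hne ?_) _
        exact ((Nat.floor_eq_iff ht.1).2 hd).symm
    · rw [Set.indicator_of_notMem ht, eq_comm]
      refine Finset.sum_eq_zero fun d hd => Set.indicator_of_notMem (fun hmem => ht ?_) _
      have h1 : ((d + 1 : ℕ) : ℝ) ≤ n := by exact_mod_cast Finset.mem_range.1 hd
      push_cast at h1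
      exact ⟨d.cast_nonneg.trans hmem.1, hmem.2.trans_le h1⟩
  rw [hfun, integral_finsetSum]
  · refine Finset.sum_congr rfl fun d _ => ?_
    rw [integral_indicator measurableSet_Ico, setIntegral_const]
    simp
  · intro d _
    rw [integrable_indicator_iff measurableSet_Ico]
    exact integrableOn_const (by simp)

/-- Together with `sum_range_eq_integral_floor`, this turns a lattice sum into an integral over the
rescaled variable, to which dominated convergence applies. -/
lemma integral_comp_const_sub_mul (H : ℝ → ℝ) (c : ℝ) {b : ℝ} (hb : 0 < b) :
    ∫ x, H (c - b * x) = b⁻¹ * ∫ t, H t := by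
  have h1 := Measure.integral_comp_mul_left (fun y => H (c - y)) b
  rw [h1, integral_sub_left_eq_self H volume c, abs_of_pos (inv_pos.2 hb), smul_eq_mul]

/-- The quotient, extended by -κ at m, is continuous and negative on the compact interval, so its
maximum there is negative. -/
lemma exists_rate_le {R : ℝ → ℝ} {m κ : ℝ} {k : ℕ} (hk : Even k) (hk0 : k ≠ 0)
    (hR : Continuous R) (hm : m ∈ Set.Ioo (0 : ℝ) 1) (hκ : 0 < κ)
    (hmax : ∀ x ∈ Set.Icc (0 : ℝ) 1, x ≠ m → R x < R m)
    (hlim : Tendsto (fun y => (R y - R m) / (y - m) ^ k) (𝓝[≠] m) (𝓝 (-κ))) :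
    ∃ c > 0, ∀ x ∈ Set.Icc (0 : ℝ) 1, R x - R m ≤ -(c * (x - m) ^ k) := by
  set r := Function.update (fun y => (R y - R m) / (y - m) ^ k) m (-κ) with hr
  have hcont : ContinuousOn r (Set.Icc 0 1) := by
    intro x _
    refine ContinuousAt.continuousWithinAt ?_
    by_cases hx : x = m
    · subst hx
      exact continuousAt_update_same.2 hlim
    · rw [hr, continuousAt_update_of_ne hx]
      have : (x - m) ^ k ≠ 0 := pow_ne_zero _ (sub_ne_zero.2 hx)
      exact ContinuousAt.div (by fun_prop) (by fun_prop) this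
  have hneg : ∀ x ∈ Set.Icc (0 : ℝ) 1, r x < 0 := by
    intro x hx
    by_cases hxm : x = m
    · subst hxm
      simp [hr, hκ]
    · rw [hr, Function.update_of_ne hxm]
      exact div_neg_of_neg_of_pos (sub_neg.2 (hmax x hx hxm)) (hk.pow_pos (sub_ne_zero.2 hxm))
  obtain ⟨z, hz, hzmax⟩ := isCompact_Icc.exists_isMaxOn (Set.nonempty_Icc.2 zero_le_one) hcont
  refine ⟨-r z, neg_pos.2 (hneg z hz), fun x hx => ?_⟩
  by_cases hxm : x = m
  · subst hxm
    simp [hk0]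
  · have h1 : r x ≤ r z := hzmax hx
    rw [hr, Function.update_of_ne hxm] at h1
    have := (div_le_iff₀ (hk.pow_pos (sub_ne_zero.2 hxm))).1 h1
    linarith

/-- The normalized weight of the configurations with `d` dimers on `N` vertices for the rate
function `R` with maximum point `m`. -/
noncomputable def normWeight (R : ℝ → ℝ) (m : ℝ) (N d : ℕ) : ℝ :=
  Real.exp (N * (R (((N - 2 * d : ℕ) : ℝ) / N) - R m)) *
    ((√N / stirlingRatio (N - 2 * d)) * (√N / stirlingRatio d))

lemma stirlingRatio_pos (n : ℕ) : 0 < stirlingRatio n :=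
  zero_lt_one.trans_le (one_le_stirlingRatio n)

lemma normWeight_nonneg (R : ℝ → ℝ) (m : ℝ) (N d : ℕ) : 0 ≤ normWeight R m N d := by
  have h1 := stirlingRatio_pos (N - 2 * d)
  have h2 := stirlingRatio_pos d
  unfold normWeight
  positivity

lemma sqrt_div_stirlingRatio_le_sqrt (N n : ℕ) : √N / stirlingRatio n ≤ √N :=
  div_le_self (Real.sqrt_nonneg _) (one_le_stirlingRatio n)

lemma sqrt_div_stirlingRatio_le {N n : ℕ} (hN : 0 < N) {θ : ℝ} (hθ : 0 < θ)
    (h : θ ≤ (n : ℝ) / N) : √N / stirlingRatio n ≤ (√θ)⁻¹ := by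
  have hN' : (0 : ℝ) < N := by exact_mod_cast hN
  have h1 : θ * N ≤ n := (le_div_iff₀ hN').1 h
  have h2 : √θ * √N ≤ √n := by
    rw [← Real.sqrt_mul hθ.le]
    exact Real.sqrt_le_sqrt h1
  have h3 : 0 < √θ := Real.sqrt_pos.2 hθ
  rw [div_le_iff₀ (stirlingRatio_pos n), ← div_eq_inv_mul, le_div_iff₀ h3, mul_comm]
  exact h2.trans (sqrt_le_stirlingRatio n)

/-- Half of the exponential decay is spent on the Stirling prefactors. They are bounded when the
density stays away from 0 and 1. Otherwise they are at most N, but the density is then at distance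
at least η from m and the decay beats N. -/
lemma exists_normWeight_le {R : ℝ → ℝ} {m κ : ℝ} {k : ℕ} (hk : Even k) (hk0 : k ≠ 0)
    (hR : Continuous R) (hm : m ∈ Set.Ioo (0 : ℝ) 1) (hκ : 0 < κ)
    (hmax : ∀ x ∈ Set.Icc (0 : ℝ) 1, x ≠ m → R x < R m)
    (hlim : Tendsto (fun y => (R y - R m) / (y - m) ^ k) (𝓝[≠] m) (𝓝 (-κ))) :
    ∃ c > 0, ∃ C, ∀ N d : ℕ, 0 < N → 2 * d ≤ N →
      normWeight R m N d ≤ C * Real.exp (-(c * (N * (((N - 2 * d : ℕ) : ℝ) / N - m) ^ k))) := by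
  obtain ⟨c, hc, hle⟩ := exists_rate_le hk hk0 hR hm hκ hmax hlim
  have hm0 := hm.1
  have hm1 : 0 < 1 - m := sub_pos.2 hm.2
  set η := min m (1 - m) / 2 with hη
  have hη0 : 0 < η := by
    have := lt_min hm0 hm1
    positivity
  have hη1 : η ≤ m / 2 := by
    have := min_le_left m (1 - m)
    linarith
  have hη2 : η ≤ (1 - m) / 2 := by
    have := min_le_right m (1 - m)
    linarith
  -- These bound the prefactors when x ≥ m/2 and 1-x ≥ (1-m)/2; the 4 arises from d/N = (1-x)/2.
  set C₁ := (√(m / 2))⁻¹ * (√((1 - m) / 4))⁻¹ with hC₁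
  set C₂ := (c / 2 * η ^ k)⁻¹ with hC₂
  have hC₁0 : 0 ≤ C₁ := by positivity
  have hC₂0 : 0 < C₂ := by positivity
  refine ⟨c / 2, by positivity, C₁ + C₂, fun N d hN hd => ?_⟩
  have hN' : (0 : ℝ) < N := by exact_mod_cast hN
  have hs : ((N - 2 * d : ℕ) : ℝ) = N - 2 * d := by push_cast [hd]; ring
  unfold normWeight
  set x := ((N - 2 * d : ℕ) : ℝ) / N with hx
  have hx0 : 0 ≤ x := by positivity
  have hdx : (d : ℝ) / N = (1 - x) / 2 := by
    rw [hx, hs]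
    field_simp
    ring
  have hx1 : x ≤ 1 := by
    have : (0 : ℝ) ≤ d / N := by positivity
    linarith
  have hu : 0 ≤ (x - m) ^ k := hk.pow_nonneg _
  have hexp : Real.exp (N * (R x - R m)) ≤
      Real.exp (-(c / 2 * (N * (x - m) ^ k))) * Real.exp (-(c / 2 * (N * (x - m) ^ k))) := by
    rw [← Real.exp_add]
    refine Real.exp_le_exp.2 ?_
    have := mul_le_mul_of_nonneg_left (hle x ⟨hx0, hx1⟩) hN'.le
    linarith
  have hE0 : Real.exp (-(c / 2 * (N * (x - m) ^ k))) ≤ 1 :=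
    Real.exp_le_one_iff.2 (neg_nonpos.2 (by positivity))
  have hEpos := Real.exp_pos (-(c / 2 * (N * (x - m) ^ k)))
  have hP0 : 0 ≤ √N / stirlingRatio (N - 2 * d) * (√N / stirlingRatio d) := by
    have h1 := stirlingRatio_pos (N - 2 * d)
    have h2 := stirlingRatio_pos d
    positivity
  set E := Real.exp (-(c / 2 * (N * (x - m) ^ k))) with hE
  suffices hsuff : E * (√N / stirlingRatio (N - 2 * d) * (√N / stirlingRatio d)) ≤ C₁ + C₂ by
    calc _ ≤ E * E * (√N / stirlingRatio (N - 2 * d) * (√N / stirlingRatio d)) :=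
          mul_le_mul_of_nonneg_right hexp hP0
      _ = E * (√N / stirlingRatio (N - 2 * d) * (√N / stirlingRatio d)) * E := by ring
      _ ≤ (C₁ + C₂) * E := mul_le_mul_of_nonneg_right hsuff hEpos.le
  by_cases hnear : m / 2 ≤ x ∧ (1 - m) / 2 ≤ 1 - x
  · have h1 := sqrt_div_stirlingRatio_le (n := N - 2 * d) hN (half_pos hm0) hnear.1
    have h2 := sqrt_div_stirlingRatio_le (n := d) hN (θ := (1 - m) / 4) (by positivity)
      (by rw [hdx]; linarith [hnear.2])
    have h3 : √N / stirlingRatio (N - 2 * d) * (√N / stirlingRatio d) ≤ C₁ :=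
      mul_le_mul h1 h2 (div_nonneg (Real.sqrt_nonneg _) (stirlingRatio_pos d).le) (by positivity)
    nlinarith
  · have hfar : η ≤ |x - m| := by
      rw [not_and_or, not_le, not_le] at hnear
      rcases hnear with h | h
      · rw [abs_sub_comm]
        exact le_trans (by linarith) (le_abs_self _)
      · exact le_trans (by linarith) (le_abs_self _)
    have h1 : η ^ k ≤ (x - m) ^ k := by
      rw [← hk.pow_abs (x - m)]
      exact pow_le_pow_left₀ hη0.le hfar k
    have h2 : √N / stirlingRatio (N - 2 * d) * (√N / stirlingRatio d) ≤ N := by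
      have := mul_le_mul (sqrt_div_stirlingRatio_le_sqrt N (N - 2 * d))
        (sqrt_div_stirlingRatio_le_sqrt N d)
        (div_nonneg (Real.sqrt_nonneg _) (stirlingRatio_pos d).le) (Real.sqrt_nonneg _)
      rwa [Real.mul_self_sqrt hN'.le] at this
    -- From e^u ≥ 1 + u with u = (c/2) N (x-m)^k ≥ (c/2) η^k N.
    have h3 : E * N ≤ C₂ := by
      have h4 : c / 2 * η ^ k * N ≤ c / 2 * (N * (x - m) ^ k) := by
        have := mul_le_mul_of_nonneg_left h1 (show 0 ≤ c / 2 * N by positivity)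
        linarith
      have h5 := Real.add_one_le_exp (c / 2 * (N * (x - m) ^ k))
      have h6 : E * Real.exp (c / 2 * (N * (x - m) ^ k)) = 1 := by
        rw [hE, ← Real.exp_add]
        simp
      have h7 : 0 < c / 2 * η ^ k := by positivity
      rw [hC₂, ← one_div, le_div_iff₀ h7]
      nlinarith
    have := mul_le_mul_of_nonneg_left h2 hEpos.le
    linarith

lemma tendsto_sqrt_div_stirlingRatio {n : ℕ → ℕ} {θ : ℝ} (hθ : 0 < θ)
    (h : Tendsto (fun N : ℕ => (n N : ℝ) / N) atTop (𝓝 θ)) :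
    Tendsto (fun N : ℕ => √N / stirlingRatio (n N)) atTop (𝓝 (√θ * (√Real.pi * √2))⁻¹) := by
  have hn : Tendsto n atTop atTop := by
    have h1 : Tendsto (fun N : ℕ => (n N : ℝ) / N * N) atTop atTop :=
      h.pos_mul_atTop hθ tendsto_natCast_atTop_atTop
    rw [← tendsto_natCast_atTop_iff (R := ℝ)]
    refine h1.congr' ?_
    filter_upwards [eventually_gt_atTop 0] with N hN
    have : (N : ℝ) ≠ 0 := by exact_mod_cast hN.ne'
    field_simp
  have h2 := (h.sqrt.mul (tendsto_stirlingRatio_div_sqrt.comp hn)).inv₀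
    (by have := Real.pi_pos; positivity)
  refine h2.congr' ?_
  filter_upwards [eventually_gt_atTop 0, hn.eventually_gt_atTop 0] with N hN hnN
  have h3 : (0 : ℝ) < N := by exact_mod_cast hN
  have h4 : (0 : ℝ) < n N := by exact_mod_cast hnN
  have h5 := stirlingRatio_pos (n N)
  simp only [Function.comp]
  rw [Real.sqrt_div h4.le]
  have : 0 < √(N : ℝ) := Real.sqrt_pos.2 h3
  have : 0 < √(n N : ℝ) := Real.sqrt_pos.2 h4
  field_simp

/-- Because q^k = N, the exponent N (R z - R m) is the quotient in `hlim` times (q (z - m))^k, which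
tends to -κ x^k. -/
lemma tendsto_normWeight {R : ℝ → ℝ} {m κ x : ℝ} {k : ℕ} (hk0 : k ≠ 0)
    (hm : m ∈ Set.Ioo (0 : ℝ) 1)
    (hlim : Tendsto (fun y => (R y - R m) / (y - m) ^ k) (𝓝[≠] m) (𝓝 (-κ)))
    {q : ℕ → ℝ} (hq : Tendsto q atTop atTop) (hqk : ∀ᶠ N : ℕ in atTop, q N ^ k = N)
    {d : ℕ → ℕ} (hd : ∀ᶠ N in atTop, 2 * d N ≤ N)
    (hX : Tendsto (fun N : ℕ => q N * (((N - 2 * d N : ℕ) : ℝ) / N - m)) atTop (𝓝 x)) :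
    Tendsto (fun N => normWeight R m N (d N)) atTop (𝓝 (Real.exp (-κ * x ^ k) *
      ((√m * (√Real.pi * √2))⁻¹ * (√((1 - m) / 2) * (√Real.pi * √2))⁻¹))) := by
  set z : ℕ → ℝ := fun N => ((N - 2 * d N : ℕ) : ℝ) / N with hz
  have hzm : Tendsto z atTop (𝓝 m) := by
    have h1 := (hX.mul hq.inv_tendsto_atTop).add_const m
    rw [mul_zero, zero_add] at h1
    refine h1.congr' ?_
    filter_upwards [hq.eventually_gt_atTop 0] with N hN
    simp only [Pi.inv_apply, hz]
    field_simp
    ring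
  have hdz : Tendsto (fun N : ℕ => (d N : ℝ) / N) atTop (𝓝 ((1 - m) / 2)) := by
    refine ((hzm.const_sub 1).div_const 2).congr' ?_
    filter_upwards [hd, eventually_gt_atTop 0] with N hN hN0
    have : (N : ℝ) ≠ 0 := by exact_mod_cast hN0.ne'
    have hs : ((N - 2 * d N : ℕ) : ℝ) = N - 2 * d N := by push_cast [hN]; ring
    simp only [hz, hs]
    field_simp
    ring
  refine Tendsto.mul ?_ ((tendsto_sqrt_div_stirlingRatio hm.1 hzm).mul
    (tendsto_sqrt_div_stirlingRatio (half_pos (sub_pos.2 hm.2)) hdz))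
  refine (Real.continuous_exp.tendsto _).comp ?_
  -- The density may equal m for some N, so the quotient is given its limit value there.
  have hr : Tendsto (Function.update (fun y => (R y - R m) / (y - m) ^ k) m (-κ)) (𝓝 m)
      (𝓝 (-κ)) := by
    have := continuousAt_update_same.2 hlim
    rwa [ContinuousAt, Function.update_self] at this
  refine ((hr.comp hzm).mul (hX.pow k)).congr' ?_
  filter_upwards [hqk] with N hN
  simp only [Function.comp]
  change _ * (q N * (z N - m)) ^ k = N * (R (z N) - R m)
  by_cases hzN : z N = m
  · simp [hzN, hk0]
  · rw [Function.update_of_ne hzN, mul_pow, hN]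
    have : (z N - m) ^ k ≠ 0 := pow_ne_zero _ (sub_ne_zero.2 hzN)
    field_simp

/-- An exponential in |x| is a convenient dominating function: displacing x by a bounded amount
costs only a constant factor. -/
lemma exp_neg_mul_pow_le {c x : ℝ} {k : ℕ} (hc : 0 ≤ c) (hk : Even k) (hk0 : k ≠ 0) :
    Real.exp (-(c * x ^ k)) ≤ Real.exp c * Real.exp (-(c * |x|)) := by
  rw [← Real.exp_add]
  refine Real.exp_le_exp.2 ?_
  have h : |x| - 1 ≤ x ^ k := by
    rw [← hk.pow_abs]
    rcases le_total |x| 1 with h1 | h1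
    · have := pow_nonneg (abs_nonneg x) k
      linarith
    · have := le_self_pow₀ h1 hk0
      linarith
  nlinarith

lemma integrable_exp_neg_mul_abs {c : ℝ} (hc : 0 < c) :
    Integrable fun x : ℝ => Real.exp (-(c * |x|)) := by
  have h1 : IntegrableOn (fun x : ℝ => Real.exp (-(c * |x|))) (Set.Ioi 0) := by
    refine (exp_neg_integrableOn_Ioi 0 hc).congr_fun (fun x hx => ?_) measurableSet_Ioi
    simp only [abs_of_pos (Set.mem_Ioi.1 hx), neg_mul]
  have h2 : IntegrableOn (fun x : ℝ => Real.exp (-(c * |x|))) (Set.Iic 0) := by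
    refine (integrableOn_exp_mul_Iic hc 0).congr_fun (fun x hx => ?_) measurableSet_Iic
    simp only [abs_of_nonpos (Set.mem_Iic.1 hx), mul_neg, neg_neg]
  rw [← integrableOn_univ, ← Set.Iic_union_Ioi (a := (0 : ℝ))]
  exact h2.union h1

lemma integrable_exp_neg_mul_pow {c : ℝ} {k : ℕ} (hc : 0 < c) (hk : Even k) (hk0 : k ≠ 0) :
    Integrable fun x : ℝ => Real.exp (-c * x ^ k) := by
  refine ((integrable_exp_neg_mul_abs hc).const_mul (Real.exp c)).mono'
    (by fun_prop) (Eventually.of_forall fun x => ?_)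
  rw [Real.norm_eq_abs, Real.abs_exp, neg_mul]
  exact exp_neg_mul_pow_le hc.le hk hk0

/-- Changing d by one moves the number of monomers by two, so the rescaled lattice has mesh 2/L and
rounding t down moves x up by at most that. -/
lemma floor_scaled_bounds {N : ℕ} {m L x : ℝ} (hL : 0 < L)
    (hx : (N * (1 - m) / 2 - L / 2 * x) ∈ Set.Ico (0 : ℝ) (N / 2 + 1 : ℕ)) :
    2 * ⌊N * (1 - m) / 2 - L / 2 * x⌋₊ ≤ N ∧
    x ≤ (((N - 2 * ⌊N * (1 - m) / 2 - L / 2 * x⌋₊ : ℕ) : ℝ) - N * m) / L ∧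
    (((N - 2 * ⌊N * (1 - m) / 2 - L / 2 * x⌋₊ : ℕ) : ℝ) - N * m) / L ≤ x + 2 / L := by
  set t := N * (1 - m) / 2 - L / 2 * x with ht
  have h0 := (Nat.floor_lt hx.1).2 hx.2
  have h1 : 2 * ⌊t⌋₊ ≤ N := by omega
  have h2 : ((N - 2 * ⌊t⌋₊ : ℕ) : ℝ) = N - 2 * ⌊t⌋₊ := by push_cast [h1]; ring
  have h3 := Nat.floor_le hx.1
  have h4 := Nat.lt_floor_add_one t
  refine ⟨h1, ?_, ?_⟩
  · rw [h2, le_div_iff₀ hL]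
    linarith
  · rw [h2, div_le_iff₀ hL, add_mul, div_mul_cancel₀ _ hL.ne']
    linarith

/-- **Laplace's method** for the weighted lattice sums of the rescaled number of monomers. -/
theorem tendsto_sum_normWeight {R : ℝ → ℝ} {m κ : ℝ} {k : ℕ} (hk : Even k) (hk0 : k ≠ 0)
    (hR : Continuous R) (hm : m ∈ Set.Ioo (0 : ℝ) 1) (hκ : 0 < κ)
    (hmax : ∀ x ∈ Set.Icc (0 : ℝ) 1, x ≠ m → R x < R m)
    (hlim : Tendsto (fun y => (R y - R m) / (y - m) ^ k) (𝓝[≠] m) (𝓝 (-κ)))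
    {q L : ℕ → ℝ} (hq : Tendsto q atTop atTop) (hqk : ∀ᶠ N : ℕ in atTop, q N ^ k = N)
    (hL : Tendsto L atTop atTop) (hLq : ∀ᶠ N : ℕ in atTop, L N * q N = N)
    {F : ℝ → ℝ} (hF : Continuous F) {B : ℝ} (hB : ∀ x, |F x| ≤ B) :
    Tendsto (fun N : ℕ => (L N / 2)⁻¹ * ∑ d ∈ Finset.range (N / 2 + 1),
        normWeight R m N d * F ((((N - 2 * d : ℕ) : ℝ) - N * m) / L N)) atTop
      (𝓝 (∫ x, Real.exp (-κ * x ^ k) * ((√m * (√Real.pi * √2))⁻¹ *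
        (√((1 - m) / 2) * (√Real.pi * √2))⁻¹) * F x)) := by
  obtain ⟨c, hc, C, hbound⟩ := exists_normWeight_le hk hk0 hR hm hκ hmax hlim
  have hB0 : 0 ≤ B := (abs_nonneg _).trans (hB 0)
  -- The number of dimers corresponding to the rescaled fluctuation x; its slope -L/2 accounts for
  -- the prefactor (L/2)⁻¹ of the sum.
  set τ : ℕ → ℝ → ℝ := fun N x => N * (1 - m) / 2 - L N / 2 * x with hτ
  set G : ℕ → ℕ → ℝ := fun N d =>
    normWeight R m N d * F ((((N - 2 * d : ℕ) : ℝ) - N * m) / L N) with hG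
  set H : ℕ → ℝ → ℝ := fun N =>
    (Set.Ico (0 : ℝ) (N / 2 + 1 : ℕ)).indicator (fun t => G N ⌊t⌋₊) with hH
  have hHmeas : ∀ N, Measurable (H N) := fun N =>
    ((measurable_from_nat (f := G N)).comp Nat.measurable_floor).indicator measurableSet_Ico
  have hmain : Tendsto (fun N => ∫ x, H N (τ N x)) atTop
      (𝓝 (∫ x, Real.exp (-κ * x ^ k) * ((√m * (√Real.pi * √2))⁻¹ *
        (√((1 - m) / 2) * (√Real.pi * √2))⁻¹) * F x)) := by
    -- The factor exp(2c) pays for the rounding error 2/L ≤ 2.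
    refine tendsto_integral_filter_of_dominated_convergence
      (fun x => |C| * (Real.exp c * (Real.exp (2 * c) * Real.exp (-(c * |x|)))) * B) ?_ ?_ ?_ ?_
    · exact Eventually.of_forall fun N =>
        ((hHmeas N).comp (by fun_prop : Measurable (τ N))).aestronglyMeasurable
    · filter_upwards [eventually_gt_atTop 0, hqk, hLq, hL.eventually_ge_atTop 1]
        with N hN hqN hLN hL1
      refine Eventually.of_forall fun x => ?_
      have hN' : (0 : ℝ) < N := by exact_mod_cast hN
      have hL0 : 0 < L N := by linarith
      by_cases ht : τ N x ∈ Set.Ico (0 : ℝ) (N / 2 + 1 : ℕ)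
      · obtain ⟨h1, h2, h3⟩ := floor_scaled_bounds hL0 ht
        simp only [hH, Set.indicator_of_mem ht]
        change ‖normWeight R m N ⌊τ N x⌋₊ *
          F ((((N - 2 * ⌊τ N x⌋₊ : ℕ) : ℝ) - N * m) / L N)‖ ≤ _
        change x ≤ (((N - 2 * ⌊τ N x⌋₊ : ℕ) : ℝ) - N * m) / L N at h2
        change (((N - 2 * ⌊τ N x⌋₊ : ℕ) : ℝ) - N * m) / L N ≤ _ at h3
        have h4 := hbound N ⌊τ N x⌋₊ hN h1
        set s := ((N - 2 * ⌊τ N x⌋₊ : ℕ) : ℝ) with hs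
        have h5 : (N : ℝ) * (s / N - m) ^ k = ((s - N * m) / L N) ^ k := by
          have h6 : (s - N * m) / L N = q N * (s / N - m) := by
            field_simp
            linear_combination -(s - N * m) * hLN
          rw [h6, mul_pow, hqN]
        rw [h5] at h4
        have h7 := exp_neg_mul_pow_le (x := (s - N * m) / L N) hc.le hk hk0
        have h8 : Real.exp (-(c * |(s - N * m) / L N|)) ≤
            Real.exp (2 * c) * Real.exp (-(c * |x|)) := by
          rw [← Real.exp_add]
          refine Real.exp_le_exp.2 ?_
          have h9 : 2 / L N ≤ 2 := div_le_self zero_le_two hL1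
          have h10 : |x| ≤ |(s - N * m) / L N| + 2 := by
            have h11 := abs_le.1 (le_refl |(s - N * m) / L N|)
            exact abs_le.2 ⟨by linarith, by linarith⟩
          nlinarith
        rw [norm_mul, Real.norm_of_nonneg (normWeight_nonneg _ _ _ _), Real.norm_eq_abs]
        refine mul_le_mul ?_ (hB _) (abs_nonneg _) (by positivity)
        refine h4.trans (mul_le_mul (le_abs_self C) (h7.trans ?_) (Real.exp_pos _).le
          (abs_nonneg C))
        exact mul_le_mul_of_nonneg_left h8 (Real.exp_pos c).le
      · simp only [hH, Set.indicator_of_notMem ht, norm_zero]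
        positivity
    · exact ((((integrable_exp_neg_mul_abs hc).const_mul _).const_mul _).const_mul _).mul_const _
    · refine Eventually.of_forall fun x => ?_
      -- Since L q = N, τ = (L/2)(q(1-m) - x), which is nonnegative once q ≥ x/(1-m); likewise τ ≤
      -- N/2 once q ≥ -x/m.
      have hev : ∀ᶠ N : ℕ in atTop, 0 < L N ∧ τ N x ∈ Set.Ico (0 : ℝ) (N / 2 + 1 : ℕ) := by
        filter_upwards [hLq, hL.eventually_gt_atTop 0,
          hq.eventually_ge_atTop (x / (1 - m)), hq.eventually_ge_atTop (-x / m)]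
          with N hLN hL0 h1 h2
        have h3 := (div_le_iff₀ (sub_pos.2 hm.2)).1 h1
        have h4 := (div_le_iff₀ hm.1).1 h2
        have h5 : 0 ≤ τ N x := by
          have := mul_nonneg hL0.le (sub_nonneg.2 h3)
          simp only [hτ]
          rw [← hLN]
          linarith
        refine ⟨hL0, h5, (Nat.floor_lt h5).1 ?_⟩
        have h6 : τ N x ≤ N / 2 := by
          have := mul_nonneg hL0.le (neg_le_iff_add_nonneg.1 h4)
          simp only [hτ]
          rw [← hLN]
          linarith
        exact Nat.lt_succ_of_le ((Nat.floor_le_floor h6).trans_eq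
          (by exact_mod_cast Nat.floor_div_eq_div (K := ℝ) N 2))
      have hX : Tendsto (fun N : ℕ => (((N - 2 * ⌊τ N x⌋₊ : ℕ) : ℝ) - N * m) / L N) atTop
          (𝓝 x) := by
        have hup : Tendsto (fun N => x + 2 / L N) atTop (𝓝 x) := by
          simpa using (hL.const_div_atTop 2).const_add x
        refine tendsto_of_tendsto_of_tendsto_of_le_of_le' tendsto_const_nhds hup ?_ ?_
        · exact hev.mono fun N hN => (floor_scaled_bounds hN.1 hN.2).2.1
        · exact hev.mono fun N hN => (floor_scaled_bounds hN.1 hN.2).2.2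
      have hX' : Tendsto (fun N : ℕ => q N * (((N - 2 * ⌊τ N x⌋₊ : ℕ) : ℝ) / N - m)) atTop
          (𝓝 x) := by
        refine hX.congr' ?_
        filter_upwards [hLq, hev, eventually_gt_atTop 0] with N hLN hN hN0
        have hN' : (0 : ℝ) < N := by exact_mod_cast hN0
        have hL0 := hN.1
        field_simp
        linear_combination -(((N - 2 * ⌊τ N x⌋₊ : ℕ) : ℝ) - N * m) * hLN
      have hW := tendsto_normWeight hk0 hm hlim hq hqk
        (hev.mono fun N hN => (floor_scaled_bounds hN.1 hN.2).1) hX'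
      refine (hW.mul ((hF.tendsto x).comp hX)).congr' ?_
      filter_upwards [hev] with N hN
      simp only [hH, Set.indicator_of_mem hN.2]
      rfl
  refine hmain.congr' ?_
  filter_upwards [hL.eventually_gt_atTop 0] with N hN
  rw [sum_range_eq_integral_floor]
  exact integral_comp_const_sub_mul (H N) _ (half_pos hN)

/-! ### Convergence in distribution under the Gibbs measure -/

instance {V : Type*} (G : SimpleGraph V) : MeasurableSingletonClass (DimerConfig G) :=
  ⟨fun _ => MeasurableSpace.measurableSet_top⟩

lemma measurable_config {N : ℕ} (f : Config N → ℝ) : Measurable f :=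
  fun _ _ => MeasurableSpace.measurableSet_top

lemma integral_gibbsMeasure (h J : ℝ) (N : ℕ) (f : Config N → ℝ) :
    ∫ D, f D ∂gibbsMeasure h J N =
      (∑ D : Config N, gibbsWeight h J D * f D) / ∑ D : Config N, gibbsWeight h J D := by
  have hint : ∀ D : Config N, Integrable f (Measure.dirac D) := fun D => Integrable.of_finite
  unfold gibbsMeasure
  rw [integral_finsetSum_measure (s := Finset.univ) (f := f)
    fun D _ => (hint D).smul_measure ENNReal.ofReal_ne_top, Finset.sum_div]
  refine Finset.sum_congr rfl fun D _ => ?_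
  rw [integral_smul_measure, integral_dirac, ENNReal.toReal_ofReal
    (div_nonneg (gibbsWeight_pos h J D).le (partitionFunction_pos h J N).le), smul_eq_mul]
  unfold partitionFunction
  ring

/-- The prefactor does not depend on F, so it cancels in Gibbs expectations. -/
lemma sum_gibbsWeight_mul_eq_normWeight (h J m : ℝ) {N : ℕ} (hN : 0 < N) (F : ℕ → ℝ) :
    ∑ D : Config N, gibbsWeight h J D * F (numMonomers D) =
      stirlingRatio N * Real.exp (N * rate h J m) / N *
        ∑ d ∈ Finset.range (N / 2 + 1), normWeight (rate h J) m N d * F (N - 2 * d) := by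
  have hN' : (0 : ℝ) < N := by exact_mod_cast hN
  rw [sum_gibbsWeight_mul h J hN, mul_div_assoc, mul_assoc]
  congr 1
  rw [Finset.mul_sum]
  refine Finset.sum_congr rfl fun d _ => ?_
  have h1 := stirlingRatio_pos (N - 2 * d)
  have h2 := stirlingRatio_pos d
  have h3 : Real.exp (N * rate h J (((N - 2 * d : ℕ) : ℝ) / N)) = Real.exp (N * rate h J m) *
      Real.exp (N * (rate h J (((N - 2 * d : ℕ) : ℝ) / N) - rate h J m)) := by
    rw [← Real.exp_add]
    congr 1
    ring
  have h4 : √(N : ℝ) * √(N : ℝ) = N := Real.mul_self_sqrt hN'.le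
  rw [h3, normWeight, div_mul_div_comm, h4]
  field_simp

/-- Convergence in distribution of the rescaled number of monomers, when the rate function has a
unique maximum point of order `k`. -/
theorem tendstoInDistribution_numMonomers {h J m κ : ℝ} {k : ℕ} (hk : Even k) (hk0 : k ≠ 0)
    (hm : m ∈ Set.Ioo (0 : ℝ) 1) (hκ : 0 < κ)
    (hmax : ∀ x ∈ Set.Icc (0 : ℝ) 1, x ≠ m → rate h J x < rate h J m)
    (hlim : Tendsto (fun y => (rate h J y - rate h J m) / (y - m) ^ k) (𝓝[≠] m) (𝓝 (-κ)))
    {q L : ℕ → ℝ} (hq : Tendsto q atTop atTop) (hqk : ∀ᶠ N : ℕ in atTop, q N ^ k = N)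
    (hL : Tendsto L atTop atTop) (hLq : ∀ᶠ N : ℕ in atTop, L N * q N = N)
    (ν : Measure ℝ) [IsProbabilityMeasure ν]
    (hν : ∀ F : ℝ → ℝ, ∫ x, F x ∂ν =
      ∫ x, (∫ y, Real.exp (-κ * y ^ k))⁻¹ * Real.exp (-κ * x ^ k) * F x) :
    TendstoInDistribution
      (fun (N : ℕ) (D : Config N) => ((numMonomers D : ℝ) - N * m) / L N)
      atTop (id : ℝ → ℝ) (fun N => gibbsMeasure h J N) ν where
  forall_aemeasurable N := (measurable_config _).aemeasurable
  aemeasurable_limit := aemeasurable_id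
  tendsto := by
    refine ProbabilityMeasure.tendsto_iff_forall_integral_tendsto.2 fun F => ?_
    have hB : ∀ x, |F x| ≤ ‖F‖ := fun x => F.norm_coe_le_norm x
    set A := (√m * (√Real.pi * √2))⁻¹ * (√((1 - m) / 2) * (√Real.pi * √2))⁻¹ with hA
    have hA0 : A ≠ 0 := by
      have h1 := hm.1
      have h2 := sub_pos.2 hm.2
      have h3 := Real.pi_pos
      positivity
    have hI0 : 0 < ∫ y : ℝ, Real.exp (-κ * y ^ k) :=
      integral_exp_pos (integrable_exp_neg_mul_pow hκ hk hk0)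
    have hnum := tendsto_sum_normWeight hk hk0 (continuous_rate h J) hm hκ hmax hlim hq hqk hL hLq
      F.continuous hB
    have hden := tendsto_sum_normWeight hk hk0 (continuous_rate h J) hm hκ hmax hlim hq hqk hL hLq
      (F := fun _ => 1) continuous_const (B := 1) (fun _ => by simp)
    rw [← hA] at hnum hden
    have hden' : ∫ x : ℝ, Real.exp (-κ * x ^ k) * A * 1 = (∫ x, Real.exp (-κ * x ^ k)) * A := by
      simp only [mul_one]
      exact integral_mul_const _ _
    have hnum' : ∫ x : ℝ, Real.exp (-κ * x ^ k) * A * F x =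
        (∫ x, Real.exp (-κ * x ^ k) * F x) * A := by
      rw [← integral_mul_const]
      congr 1
      funext x
      ring
    rw [hden'] at hden
    rw [hnum'] at hnum
    -- The limit A of the Stirling prefactors is common to numerator and denominator and cancels.
    have hlimit := hnum.div hden (mul_ne_zero hI0.ne' hA0)
    have hval : (∫ x, Real.exp (-κ * x ^ k) * F x) * A / ((∫ x, Real.exp (-κ * x ^ k)) * A) =
        ∫ x, F x ∂ν := by
      rw [hν, mul_div_mul_right _ _ hA0, div_eq_inv_mul, ← integral_const_mul]
      congr 1
      funext x
      ring
    rw [hval] at hlimit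
    simp only [ProbabilityMeasure.coe_mk, Measure.map_id]
    refine hlimit.congr' ?_
    filter_upwards [eventually_gt_atTop 0, hL.eventually_gt_atTop 0] with N hN hL0
    have hN' : (0 : ℝ) < N := by exact_mod_cast hN
    rw [integral_map (measurable_config _).aemeasurable
      F.continuous.aestronglyMeasurable, integral_gibbsMeasure]
    have h1 := sum_gibbsWeight_mul_eq_normWeight h J m hN
      (fun n => F (((n : ℝ) - N * m) / L N))
    have h2 := sum_gibbsWeight_mul_eq_normWeight h J m hN (fun _ => 1)
    simp only [mul_one] at h2
    simp only [mul_one, Pi.div_apply]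
    rw [h1, h2, mul_div_mul_left, mul_div_mul_left]
    · have := stirlingRatio_pos N
      positivity
    · positivity

/-! ### The Gaussian and quartic limit laws -/

lemma integral_gaussianReal_eq {κ : ℝ} (hκ : 0 < κ) {v : ℝ} (hv : v = (2 * κ)⁻¹) (F : ℝ → ℝ) :
    ∫ x, F x ∂gaussianReal 0 v.toNNReal =
      ∫ x, (∫ y : ℝ, Real.exp (-κ * y ^ 2))⁻¹ * Real.exp (-κ * x ^ 2) * F x := by
  have hv0 : 0 < v := by rw [hv]; positivity
  have hne : v.toNNReal ≠ 0 := (Real.toNNReal_pos.2 hv0).ne'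
  rw [integral_gaussianReal_eq_integral_smul hne, integral_gaussian]
  congr 1
  funext x
  rw [smul_eq_mul, gaussianPDFReal, Real.coe_toNNReal v hv0.le, hv]
  congr 3
  · congr 1
    field_simp
  · field_simp
    ring

lemma isProbabilityMeasure_quarticMeasure {lam : ℝ} (hlam : lam < 0) :
    IsProbabilityMeasure (quarticMeasure lam) := by
  have hint : Integrable fun x : ℝ => Real.exp (lam / 24 * x ^ 4) := by
    have := integrable_exp_neg_mul_pow (c := -(lam / 24)) (k := 4) (by linarith) (by decide)
      (by decide)
    simpa using this
  have hI := integral_exp_pos hint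
  constructor
  rw [quarticMeasure, withDensity_apply _ MeasurableSet.univ, setLIntegral_univ,
    ← ofReal_integral_eq_lintegral_ofReal (hint.const_mul _)
      (Eventually.of_forall fun x => mul_nonneg (inv_nonneg.2 hI.le) (Real.exp_pos _).le),
    integral_const_mul, inv_mul_cancel₀ hI.ne', ENNReal.ofReal_one]

lemma integral_quarticMeasure (lam : ℝ) (F : ℝ → ℝ) :
    ∫ x, F x ∂quarticMeasure lam =
      ∫ x, (∫ y : ℝ, Real.exp (lam / 24 * y ^ 4))⁻¹ * Real.exp (lam / 24 * x ^ 4) * F x := by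
  have h0 : ∀ x : ℝ, 0 ≤ (∫ y : ℝ, Real.exp (lam / 24 * y ^ 4))⁻¹ * Real.exp (lam / 24 * x ^ 4) :=
    fun x => mul_nonneg (inv_nonneg.2 (integral_nonneg fun y => (Real.exp_pos _).le))
      (Real.exp_pos _).le
  rw [quarticMeasure, integral_withDensity_eq_integral_toReal_smul (by fun_prop)
    (Eventually.of_forall fun _ => ENNReal.ofReal_lt_top)]
  congr 1
  funext x
  rw [ENNReal.toReal_ofReal (h0 x), smul_eq_mul]

lemma tendsto_natCast_rpow {r : ℝ} (hr : 0 < r) :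
    Tendsto (fun N : ℕ => (N : ℝ) ^ r) atTop atTop :=
  (tendsto_rpow_atTop hr).comp tendsto_natCast_atTop_atTop

lemma eventually_rpow_mul_rpow {r s : ℝ} (hrs : r + s = 1) :
    ∀ᶠ N : ℕ in atTop, (N : ℝ) ^ r * (N : ℝ) ^ s = N := by
  filter_upwards [eventually_gt_atTop 0] with N hN
  rw [← Real.rpow_add (by exact_mod_cast hN), hrs, Real.rpow_one]

lemma rpow_one_div_pow (N : ℕ) {k : ℕ} (hk : k ≠ 0) : ((N : ℝ) ^ (1 / k : ℝ)) ^ k = N := by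
  rw [one_div, Real.rpow_inv_natCast_pow N.cast_nonneg hk]

theorem tendstoInDistribution_gaussian {h J m : ℝ} (hJ : 0 < J)
    (hm : IsUniqueGlobalMax (variationalPressure h J) m) (hD : 2 * J < gInvDeriv m) :
    TendstoInDistribution
      (fun (N : ℕ) (D : Config N) => ((numMonomers D : ℝ) - N * m) / (N : ℝ) ^ (1 / 2 : ℝ))
      atTop (id : ℝ → ℝ) (fun N => gibbsMeasure h J N)
      (gaussianReal 0 ((gInvDeriv m - 2 * J)⁻¹).toNNReal) := by
  have hmem := hm.1.mem_Ioo hJ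
  have hκ : 0 < (gInvDeriv m - 2 * J) / 2 := by linarith
  refine tendstoInDistribution_numMonomers (k := 2) (κ := (gInvDeriv m - 2 * J) / 2)
    (q := fun N => (N : ℝ) ^ (1 / 2 : ℝ)) (by decide) (by decide) hmem hκ
    (fun x hx hne => hm.rate_lt hJ hx hne)
    (tendsto_rate_div_sq hmem (hm.1.rateDeriv_eq_zero hJ)) (tendsto_natCast_rpow (by norm_num))
    (Eventually.of_forall fun N => ?_) (tendsto_natCast_rpow (by norm_num))
    (eventually_rpow_mul_rpow (by norm_num)) _
    (integral_gaussianReal_eq hκ (by rw [mul_div_cancel₀ _ two_ne_zero]))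
  exact_mod_cast rpow_one_div_pow N (k := 2) (by decide)

lemma iteratedDeriv_four_crit_neg :
    iteratedDeriv 4 (variationalPressure critH critJ) critDensity < 0 := by
  rw [iteratedDeriv_four_crit]
  have h1 := critDensity_mem.1
  have h2 := sub_pos.2 critDensity_mem.2
  have h3 := critJ_pos
  rw [neg_lt_zero]
  positivity

theorem tendstoInDistribution_crit {lam : ℝ}
    (hlam : lam = iteratedDeriv 4 (variationalPressure critH critJ) critDensity)
    [IsProbabilityMeasure (quarticMeasure lam)] :
    TendstoInDistribution
      (fun (N : ℕ) (D : Config N) =>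
        ((numMonomers D : ℝ) - N * critDensity) / (N : ℝ) ^ (3 / 4 : ℝ))
      atTop (id : ℝ → ℝ) (fun N => gibbsMeasure critH critJ N) (quarticMeasure lam) := by
  have hneg : lam < 0 := hlam ▸ iteratedDeriv_four_crit_neg
  have hκ : 0 < -(lam / 24) := by linarith
  -- The pressure and the rate have different fourth-order behaviour in general, but at the critical
  -- point λ/24 equals the quartic coefficient of the rate: both are -`critJ`/(6 m (1-m)) with m =
  -- `critDensity`.
  have hlim : Tendsto (fun y => (rate critH critJ y - rate critH critJ critDensity) /
      (y - critDensity) ^ 4) (𝓝[≠] critDensity) (𝓝 (-(-(lam / 24)))) := by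
    convert tendsto_rate_crit_div_pow_four using 2
    rw [hlam, iteratedDeriv_four_crit]
    have h1 := critDensity_mem.1
    have h2 := sub_pos.2 critDensity_mem.2
    field_simp
    ring
  refine tendstoInDistribution_numMonomers (k := 4) (κ := -(lam / 24))
    (q := fun N => (N : ℝ) ^ (1 / 4 : ℝ)) (by decide) (by decide) critDensity_mem hκ
    (fun x hx hne => isUniqueGlobalMax_crit.rate_lt critJ_pos hx hne)
    hlim (tendsto_natCast_rpow (by norm_num))
    (Eventually.of_forall fun N => ?_) (tendsto_natCast_rpow (by norm_num))
    (eventually_rpow_mul_rpow (by norm_num)) _ (fun F => ?_)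
  · exact_mod_cast rpow_one_div_pow N (k := 4) (by decide)
  · rw [integral_quarticMeasure, neg_neg]

end IMD

theorem theorem3 :
    ∃ hc Jc : ℝ, 0 < Jc ∧
      -- `(hc, Jc)` is the endpoint of the curve, which itself does not contain it
      closure IMD.coexistenceCurve \ IMD.coexistenceCurve = {(hc, Jc)} ∧
      -- central limit theorem
      (∀ h J : ℝ, 0 < J → (h, J) ∉ IMD.coexistenceCurve → (h, J) ≠ (hc, Jc) →
        ∃ m lam sigmaSq : ℝ,
          IMD.IsUniqueGlobalMax (IMD.variationalPressure h J) m ∧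
          lam = iteratedDeriv 2 (IMD.variationalPressure h J) m ∧ lam < 0 ∧
          sigmaSq = -lam⁻¹ - (2 * J)⁻¹ ∧ 0 < sigmaSq ∧
          TendstoInDistribution
            (fun (N : ℕ) (D : IMD.Config N) =>
              ((IMD.numMonomers D : ℝ) - (N : ℝ) * m) / (N : ℝ) ^ (1 / 2 : ℝ))
            atTop (id : ℝ → ℝ) (fun N : ℕ => IMD.gibbsMeasure h J N)
            (gaussianReal 0 sigmaSq.toNNReal)) ∧
      -- behaviour at the critical point
      (∃ mc lamc : ℝ,
        IMD.IsUniqueGlobalMax (IMD.variationalPressure hc Jc) mc ∧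
        lamc = iteratedDeriv 4 (IMD.variationalPressure hc Jc) mc ∧ lamc < 0 ∧
        ∃ _ : IsProbabilityMeasure (IMD.quarticMeasure lamc),
          TendstoInDistribution
            (fun (N : ℕ) (D : IMD.Config N) =>
              ((IMD.numMonomers D : ℝ) - (N : ℝ) * mc) / (N : ℝ) ^ (3 / 4 : ℝ))
            atTop (id : ℝ → ℝ) (fun N : ℕ => IMD.gibbsMeasure hc Jc N)
            (IMD.quarticMeasure lamc)) := by
  refine ⟨IMD.critH, IMD.critJ, IMD.critJ_pos, IMD.closure_diff_coexistenceCurve, ?_, ?_⟩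
  · intro h J hJ hγ hne
    obtain ⟨m, hm⟩ := IMD.exists_isUniqueGlobalMax hJ hγ
    have hD := IMD.lt_gInvDeriv_of_ne_crit hJ hne hm.1
    have hDpos : 0 < IMD.gInvDeriv m := IMD.gInvDeriv_pos (hm.1.mem_Ioo hJ)
    have hsub : 0 < IMD.gInvDeriv m - 2 * J := sub_pos.2 hD
    have hlam := hm.1.iteratedDeriv_two hJ
    -- With D = `gInvDeriv m`, λ = -2J(D-2J)/D, hence -1/λ - 1/(2J) = 1/(D-2J), the variance
    -- produced by Laplace's method.
    have hlam' : 2 * J * (2 * J * (IMD.gInvDeriv m)⁻¹ - 1) =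
        -(2 * J * (IMD.gInvDeriv m - 2 * J) / IMD.gInvDeriv m) := by
      field_simp
      ring
    refine ⟨m, _, (IMD.gInvDeriv m - 2 * J)⁻¹, hm, rfl, ?_, ?_, inv_pos.2 hsub,
      IMD.tendstoInDistribution_gaussian hJ hm hD⟩
    · rw [hlam, hlam', neg_lt_zero]
      positivity
    · rw [hlam, hlam', inv_neg, neg_neg, inv_div]
      field_simp
      ring
  · exact ⟨IMD.critDensity, _, IMD.isUniqueGlobalMax_crit, rfl, IMD.iteratedDeriv_four_crit_neg,
      IMD.isProbabilityMeasure_quarticMeasure IMD.iteratedDeriv_four_crit_neg,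
      @IMD.tendstoInDistribution_crit _ rfl
        (IMD.isProbabilityMeasure_quarticMeasure IMD.iteratedDeriv_four_crit_neg)⟩
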